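/- There is an algorithm (a single real-RAM program, for all $m,n$ and $X$) which, given positive integers $m,n$ and a matrix $X=(x_{ij})\in[0,1)^{m\times n}$, computes a matrix $Y=(y_{ij})\in\{0,1\}^{m\times n}$ that is a rounding of $X$ (that is, $y_{ij}\in\{\lfloor x_{ij}\rfloor,\lceil x_{ij}\rceil\}$ for all $i,j$) such that $$\Big|\sum_{j=1}^{b}(x_{ij}-y_{ij})\Big|<1\quad\text{for all } i\in\{1,\dots,m\},\ b\in\{1,\dots,n\},$$ $$\Big|\sum_{i=1}^{b}(x_{ij}-y_{ij})\Big|<1\quad\text{for all } j\in\{1,\dots,n\},\ b\in\{1,\dots,m\},$$ $$\Big|\sum_{i=1}^{m}\sum_{j=1}^{n}(x_{ij}-y_{ij})\Big|<1,$$ and whose running time is $O(mn\log(mn))$ for $mn\ge 2$ and $O(1)$ for $m=n=1$, with an absolute implied constant. Here time is the number of unit-cost operations of a real RAM: a machine with registers and arrays holding natural numbers or real numbers, whose operations are reading and writing cells, addition, subtraction and comparison (of naturals or of reals), conditional branching and loops, with the real constants $0$ and $1$ only; initially it holds $m$, $n$ and the entries of $X$, and all other cells are zero. -/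

import Mathlib

/-!
A uniform-cost real RAM.  A machine has natural-number registers and arrays (for indices,
counters and pointers) and real registers and arrays.  The primitive operations are
addition, subtraction and comparison; there is no multiplication, no rounding, no passage from
real to natural cells, and the only real constants are `0` and `1`.  Every primitive operation,
every register or array access, every assignment and every branch costs one unit of time.
-/

namespace RealRAM

/-- Memory contents. The first argument of `narr` and `rarr` is the name of the array, the second
the position in it. -/
structure State where
  nreg : ℕ → ℕ
  rreg : ℕ → ℝ
  narr : ℕ → ℕ → ℕ
  rarr : ℕ → ℕ → ℝ

/-- Natural-number expressions; `get a e` reads array `a` at the position given by `e`, and `sub`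
is truncated subtraction. -/
inductive NExp where
  | const (k : ℕ)
  | reg (v : ℕ)
  | get (a : ℕ) (e : NExp)
  | add (e f : NExp)
  | sub (e f : NExp)

/-- Real expressions. -/
inductive RExp where
  | zero
  | one
  | reg (v : ℕ)
  | get (a : ℕ) (e : NExp)
  | add (e f : RExp)
  | sub (e f : RExp)

/-- Tests. -/
inductive Test where
  | nle (e f : NExp)
  | rle (e f : RExp)
  | not (b : Test)
  | and (b c : Test)

/-- Programs. Array names are part of the program text; array positions are computed. -/
inductive Prog where
  | skip
  | setN (v : ℕ) (e : NExp)
  | setR (v : ℕ) (e : RExp)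
  | putN (a : ℕ) (i : NExp) (e : NExp)
  | putR (a : ℕ) (i : NExp) (e : RExp)
  | seq (p q : Prog)
  | ite (b : Test) (p q : Prog)
  | loop (b : Test) (p : Prog)

def NExp.eval (s : State) : NExp → ℕ
  | .const k => k
  | .reg v => s.nreg v
  | .get a e => s.narr a (e.eval s)
  | .add e f => e.eval s + f.eval s
  | .sub e f => e.eval s - f.eval s

noncomputable def RExp.eval (s : State) : RExp → ℝ
  | .zero => 0
  | .one => 1
  | .reg v => s.rreg v
  | .get a e => s.rarr a (e.eval s)
  | .add e f => e.eval s + f.eval s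
  | .sub e f => e.eval s - f.eval s

def Test.eval (s : State) : Test → Prop
  | .nle e f => e.eval s ≤ f.eval s
  | .rle e f => e.eval s ≤ f.eval s
  | .not b => ¬ b.eval s
  | .and b c => b.eval s ∧ c.eval s

/-- The time to evaluate an expression: one unit for each operation, constant or memory access. -/
def NExp.cost : NExp → ℕ
  | .const _ => 1
  | .reg _ => 1
  | .get _ e => e.cost + 1
  | .add e f => e.cost + f.cost + 1
  | .sub e f => e.cost + f.cost + 1

def RExp.cost : RExp → ℕ
  | .zero => 1
  | .one => 1
  | .reg _ => 1
  | .get _ e => e.cost + 1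
  | .add e f => e.cost + f.cost + 1
  | .sub e f => e.cost + f.cost + 1

def Test.cost : Test → ℕ
  | .nle e f => e.cost + f.cost + 1
  | .rle e f => e.cost + f.cost + 1
  | .not b => b.cost + 1
  | .and b c => b.cost + c.cost + 1

/-- `Exec p s t s'`: program `p`, started in state `s`, halts after `t` units of time in
state `s'`. `loop b p` is "while `b` do `p`". -/
inductive Exec : Prog → State → ℕ → State → Prop
  | skip (s : State) : Exec .skip s 1 s
  | setN (v : ℕ) (e : NExp) (s : State) :
      Exec (.setN v e) s (e.cost + 1) { s with nreg := Function.update s.nreg v (e.eval s) }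
  | setR (v : ℕ) (e : RExp) (s : State) :
      Exec (.setR v e) s (e.cost + 1) { s with rreg := Function.update s.rreg v (e.eval s) }
  | putN (a : ℕ) (i e : NExp) (s : State) :
      Exec (.putN a i e) s (i.cost + e.cost + 1)
        { s with narr :=
            Function.update s.narr a (Function.update (s.narr a) (i.eval s) (e.eval s)) }
  | putR (a : ℕ) (i : NExp) (e : RExp) (s : State) :
      Exec (.putR a i e) s (i.cost + e.cost + 1)
        { s with rarr :=
            Function.update s.rarr a (Function.update (s.rarr a) (i.eval s) (e.eval s)) }
  | seq {p q : Prog} {s s' s'' : State} {t t' : ℕ} :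
      Exec p s t s' → Exec q s' t' s'' → Exec (.seq p q) s (t + t') s''
  | iteTrue {b : Test} {p q : Prog} {s s' : State} {t : ℕ} :
      b.eval s → Exec p s t s' → Exec (.ite b p q) s (b.cost + 1 + t) s'
  | iteFalse {b : Test} {p q : Prog} {s s' : State} {t : ℕ} :
      ¬ b.eval s → Exec q s t s' → Exec (.ite b p q) s (b.cost + 1 + t) s'
  | loopTrue {b : Test} {p : Prog} {s s' s'' : State} {t t' : ℕ} :
      b.eval s → Exec p s t s' → Exec (.loop b p) s' t' s'' →
        Exec (.loop b p) s (b.cost + 1 + t + t') s''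
  | loopFalse {b : Test} {p : Prog} {s : State} :
      ¬ b.eval s → Exec (.loop b p) s (b.cost + 1) s

/-- Execution is deterministic: the running time and the final state are unique. -/
theorem Exec.unique {p : Prog} {s s₁ s₂ : State} {t₁ t₂ : ℕ}
    (h₁ : Exec p s t₁ s₁) (h₂ : Exec p s t₂ s₂) : t₁ = t₂ ∧ s₁ = s₂ := by
  induction h₁ generalizing t₂ s₂ with
  | skip | setN | setR | putN | putR => cases h₂; exact ⟨rfl, rfl⟩
  | seq _ _ ih ih' =>
    cases h₂ with
    | seq a b =>
      obtain ⟨rfl, rfl⟩ := ih a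
      obtain ⟨rfl, rfl⟩ := ih' b
      exact ⟨rfl, rfl⟩
  | iteTrue hb _ ih =>
    cases h₂ with
    | iteTrue _ a => obtain ⟨rfl, rfl⟩ := ih a; exact ⟨rfl, rfl⟩
    | iteFalse hn _ => exact absurd hb hn
  | iteFalse hb _ ih =>
    cases h₂ with
    | iteTrue hn _ => exact absurd hn hb
    | iteFalse _ a => obtain ⟨rfl, rfl⟩ := ih a; exact ⟨rfl, rfl⟩
  | loopTrue hb _ _ ih ih' =>
    cases h₂ with
    | loopTrue _ a b =>
      obtain ⟨rfl, rfl⟩ := ih a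
      obtain ⟨rfl, rfl⟩ := ih' b
      exact ⟨rfl, rfl⟩
    | loopFalse hn => exact absurd hb hn
  | loopFalse hb =>
    cases h₂ with
    | loopTrue hn _ _ => exact absurd hn hb
    | loopFalse _ => exact ⟨rfl, rfl⟩

/-- The initial state on input `X`: registers `0` and `1` hold the numbers of rows and of columns,
real array `0` holds `X` row by row, and all other cells are zero. -/
noncomputable def input {m n : ℕ} (X : Matrix (Fin m) (Fin n) ℝ) : State where
  nreg v := if v = 0 then m else if v = 1 then n else 0
  rreg _ := 0
  narr _ _ := 0
  rarr a k := if h : a = 0 ∧ k < m * n then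
    X (Fin.divNat ⟨k, h.2⟩) (Fin.modNat ⟨k, h.2⟩) else 0

theorem input_rarr {m n : ℕ} (X : Matrix (Fin m) (Fin n) ℝ) (i : Fin m) (j : Fin n) :
    (input X).rarr 0 (i * n + j) = X i j := by
  have hn : 0 < n := j.pos
  have h : (i : ℕ) * n + j < m * n := by
    calc (i : ℕ) * n + j < i * n + n := by have := j.isLt; omega
      _ = (i + 1) * n := by ring
      _ ≤ m * n := Nat.mul_le_mul_right _ i.isLt
  have h1 : ((i : ℕ) * n + j) / n = i := by
    rw [add_comm, Nat.add_mul_div_right _ _ hn, Nat.div_eq_of_lt j.isLt, zero_add]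
  have h2 : ((i : ℕ) * n + j) % n = j := by
    rw [add_comm, Nat.add_mul_mod_self_right, Nat.mod_eq_of_lt j.isLt]
  have e1 : Fin.divNat (⟨(i : ℕ) * n + j, h⟩ : Fin (m * n)) = i := Fin.ext h1
  have e2 : Fin.modNat (⟨(i : ℕ) * n + j, h⟩ : Fin (m * n)) = j := Fin.ext h2
  simp [input, h, e1, e2]

/-- The `m × n` matrix that natural-number array `0` holds row by row. -/
def output (m n : ℕ) (s : State) : Matrix (Fin m) (Fin n) ℕ :=
  fun i j => s.narr 0 (i * n + j)

end RealRAM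

/-- `Y` is a 0/1 matrix that rounds `X` entry by entry, with error less than one in every initial
interval of every row and of every column and in the sum of all entries. -/
def IsGoodRounding {m n : ℕ} (X : Matrix (Fin m) (Fin n) ℝ) (Y : Matrix (Fin m) (Fin n) ℕ) :
    Prop :=
  (∀ i j, Y i j = 0 ∨ Y i j = 1) ∧
  (∀ i j, (Y i j : ℤ) = ⌊X i j⌋ ∨ (Y i j : ℤ) = ⌈X i j⌉) ∧
  (∀ (i : Fin m) (b : Fin n), |∑ j ∈ Finset.Iic b, (X i j - (Y i j : ℝ))| < 1) ∧
  (∀ (j : Fin n) (b : Fin m), |∑ i ∈ Finset.Iic b, (X i j - (Y i j : ℝ))| < 1) ∧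
  |∑ i : Fin m, ∑ j : Fin n, (X i j - (Y i j : ℝ))| < 1

/-! Let `N = m * n` and let `T` be least with `2 ^ T > 2 * N`. Write `2 ^ T * x e = K e + f e` with
`K e` a natural number and `0 ≤ f e < 1`. Run through the entries row by row, accumulate the `f e`,
and emit a carry 0 or 1 after each entry; the carries become the weights of `N` dummy entries
interleaved with the true ones. A second set of `N` dummies serves the column order. An interval of
either order, dummies included, then has an integer weight that differs from `2 ^ T` times its sum
of `X` by less than 1 (`Layout.sum_entries`).

The `3 * N` weights are halved `T` times, and in each round only odd weights require a choice. Along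
the row order, consecutive odd vertices of a row are matched, and the leftovers of the rows are
matched with one another; a second matching comes from the columns. The union of two matchings
consists of paths and even cycles, so it has a proper 2-colouring (`Walk.step`, `Walk.turn`,
`color_spec`). One colour is rounded up and the other down. Matched vertices cancel, so each initial
part of a line, and the whole order, keeps at most one uncancelled unit (`sweep_spec`). The colour
to round up is the one less frequent among the odd dummies, so rounding does not raise the total
weight of the dummies above half of its former value.

In the original scale the errors add up to at most `1 + 2 + ⋯ + 2 ^ (T - 1) = 2 ^ T - 1`
(`abs_halving`). The dummies start with total weight at most `2 * N < 2 ^ T`, so they end at 0. What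
remains are entries in `{0, 1}` whose sums differ from those of `X` by less than `((2 ^ T - 1) + 1)
/ 2 ^ T = 1` (`isGoodRounding_of_progress`).

A round takes time `O(N)`, since each step of a colouring walk colours a new vertex, and there are
`T = O(log (2 * N))` rounds. -/

namespace RealRAM

/-! ### Rules for running time, final states and untouched cells of programs -/

/-- Assignment to a natural-number register. -/
def State.setN (s : State) (v k : ℕ) : State := { s with nreg := Function.update s.nreg v k }

namespace Prog

/-- The program contains no loop. -/
def loopFree : Prog → Bool
  | skip => true
  | setN _ _ => true
  | setR _ _ => true
  | putN _ _ _ => true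
  | putR _ _ _ => true
  | seq p q => p.loopFree && q.loopFree
  | ite _ p q => p.loopFree && q.loopFree
  | loop _ _ => false

open Classical in
/-- The final state of a loop-free program. -/
noncomputable def run : Prog → State → State
  | skip, s => s
  | setN v e, s => { s with nreg := Function.update s.nreg v (e.eval s) }
  | setR v e, s => { s with rreg := Function.update s.rreg v (e.eval s) }
  | putN a i e, s => { s with
    narr :=
      Function.update s.narr a (Function.update (s.narr a) (i.eval s) (e.eval s)) }
  | putR a i e, s => { s with
    rarr :=
      Function.update s.rarr a (Function.update (s.rarr a) (i.eval s) (e.eval s)) }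
  | seq p q, s => q.run (p.run s)
  | ite b p q, s => if b.eval s then p.run s else q.run s
  | loop _ _, s => s

/-- An upper bound for the running time of a loop-free program. -/
def wcost : Prog → ℕ
  | skip => 1
  | setN _ e => e.cost + 1
  | setR _ e => e.cost + 1
  | putN _ i e => i.cost + e.cost + 1
  | putR _ i e => i.cost + e.cost + 1
  | seq p q => p.wcost + q.wcost
  | ite b p q => b.cost + 1 + (p.wcost + q.wcost)
  | loop _ _ => 0

/-- The natural-number registers that a program may write. -/
def nregs : Prog → List ℕ
  | setN v _ => [v]
  | seq p q => p.nregs ++ q.nregs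
  | ite _ p q => p.nregs ++ q.nregs
  | loop _ p => p.nregs
  | _ => []

/-- The real registers that a program may write. -/
def rregs : Prog → List ℕ
  | setR v _ => [v]
  | seq p q => p.rregs ++ q.rregs
  | ite _ p q => p.rregs ++ q.rregs
  | loop _ p => p.rregs
  | _ => []

/-- The natural-number arrays that a program may write. -/
def narrs : Prog → List ℕ
  | putN a _ _ => [a]
  | seq p q => p.narrs ++ q.narrs
  | ite _ p q => p.narrs ++ q.narrs
  | loop _ p => p.narrs
  | _ => []

/-- The real arrays that a program may write. -/
def rarrs : Prog → List ℕ
  | putR a _ _ => [a]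
  | seq p q => p.rarrs ++ q.rarrs
  | ite _ p q => p.rarrs ++ q.rarrs
  | loop _ p => p.rarrs
  | _ => []

end Prog

/-- `s'` agrees with `s` on all cells that `p` does not write. -/
structure Frame (p : Prog) (s s' : State) : Prop where
  nreg : ∀ v, v ∉ p.nregs → s'.nreg v = s.nreg v
  rreg : ∀ v, v ∉ p.rregs → s'.rreg v = s.rreg v
  narr : ∀ a, a ∉ p.narrs → s'.narr a = s.narr a
  rarr : ∀ a, a ∉ p.rarrs → s'.rarr a = s.rarr a

theorem Frame.refl (p : Prog) (s : State) : Frame p s s :=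
  ⟨fun _ _ => rfl, fun _ _ => rfl, fun _ _ => rfl, fun _ _ => rfl⟩

theorem Frame.trans {p : Prog} {s s' s'' : State} (h : Frame p s s') (h' : Frame p s' s'') :
    Frame p s s'' :=
  ⟨fun v hv => (h'.nreg v hv).trans (h.nreg v hv), fun v hv => (h'.rreg v hv).trans (h.rreg v hv),
    fun v hv => (h'.narr v hv).trans (h.narr v hv), fun v hv => (h'.rarr v hv).trans (h.rarr v hv)⟩

theorem Frame.mono {p q : Prog} {s s' : State} (h : Frame p s s') (h₁ : p.nregs ⊆ q.nregs)
    (h₂ : p.rregs ⊆ q.rregs) (h₃ : p.narrs ⊆ q.narrs) (h₄ : p.rarrs ⊆ q.rarrs) : Frame q s s' :=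
  ⟨fun v hv => h.nreg v fun hh => hv (h₁ hh), fun v hv => h.rreg v fun hh => hv (h₂ hh),
    fun v hv => h.narr v fun hh => hv (h₃ hh), fun v hv => h.rarr v fun hh => hv (h₄ hh)⟩

/-- A program changes only the cells it writes. -/
theorem Exec.frame {p : Prog} {s s' : State} {t : ℕ} (h : Exec p s t s') : Frame p s s' := by
  induction h with
  | skip => exact Frame.refl _ _
  | setN v e s =>
    exact ⟨fun w hw => Function.update_of_ne (by simpa [Prog.nregs] using hw) _ _,
      fun _ _ => rfl, fun _ _ => rfl, fun _ _ => rfl⟩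
  | setR v e s =>
    exact ⟨fun _ _ => rfl, fun w hw => Function.update_of_ne (by simpa [Prog.rregs] using hw) _ _,
      fun _ _ => rfl, fun _ _ => rfl⟩
  | putN a i e s =>
    exact ⟨fun _ _ => rfl, fun _ _ => rfl,
      fun w hw => Function.update_of_ne (by simpa [Prog.narrs] using hw) _ _, fun _ _ => rfl⟩
  | putR a i e s =>
    exact ⟨fun _ _ => rfl, fun _ _ => rfl, fun _ _ => rfl,
      fun w hw => Function.update_of_ne (by simpa [Prog.rarrs] using hw) _ _⟩
  | seq _ _ ih ih' =>
    exact (ih.mono (by simp [Prog.nregs]) (by simp [Prog.rregs]) (by simp [Prog.narrs])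
      (by simp [Prog.rarrs])).trans (ih'.mono (by simp [Prog.nregs]) (by simp [Prog.rregs])
      (by simp [Prog.narrs]) (by simp [Prog.rarrs]))
  | iteTrue _ _ ih =>
    exact ih.mono (by simp [Prog.nregs]) (by simp [Prog.rregs]) (by simp [Prog.narrs])
      (by simp [Prog.rarrs])
  | iteFalse _ _ ih =>
    exact ih.mono (by simp [Prog.nregs]) (by simp [Prog.rregs]) (by simp [Prog.narrs])
      (by simp [Prog.rarrs])
  | loopTrue _ _ _ ih ih' =>
    exact (ih.mono (by simp [Prog.nregs]) (by simp [Prog.rregs]) (by simp [Prog.narrs])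
      (by simp [Prog.rarrs])).trans ih'
  | loopFalse => exact Frame.refl _ _

/-- A loop-free program halts in the state `p.run s`, in time at most `p.wcost`. -/
theorem exec_run {p : Prog} (hp : p.loopFree = true) (s : State) :
    ∃ t ≤ p.wcost, Exec p s t (p.run s) := by
  induction p generalizing s with
  | skip => exact ⟨_, le_rfl, .skip s⟩
  | setN v e => exact ⟨_, le_rfl, .setN v e s⟩
  | setR v e => exact ⟨_, le_rfl, .setR v e s⟩
  | putN a i e => exact ⟨_, le_rfl, .putN a i e s⟩
  | putR a i e => exact ⟨_, le_rfl, .putR a i e s⟩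
  | seq p q ihp ihq =>
    simp only [Prog.loopFree, Bool.and_eq_true] at hp
    obtain ⟨t, ht, h⟩ := ihp hp.1 s
    obtain ⟨t', ht', h'⟩ := ihq hp.2 (p.run s)
    exact ⟨t + t', Nat.add_le_add ht ht', .seq h h'⟩
  | ite b p q ihp ihq =>
    simp only [Prog.loopFree, Bool.and_eq_true] at hp
    by_cases hb : b.eval s
    · obtain ⟨t, ht, h⟩ := ihp hp.1 s
      refine ⟨_, ?_, by simpa [Prog.run, hb] using Exec.iteTrue hb h⟩
      simp only [Prog.wcost]; omega
    · obtain ⟨t, ht, h⟩ := ihq hp.2 s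
      refine ⟨_, ?_, by simpa [Prog.run, hb] using Exec.iteFalse hb h⟩
      simp only [Prog.wcost]; omega
  | loop => simp [Prog.loopFree] at hp

/-- `p`, started in `s`, halts, and `Q` holds of the running time and the final state. -/
def Runs (p : Prog) (s : State) (Q : ℕ → State → Prop) : Prop :=
  ∃ t s', Exec p s t s' ∧ Q t s'

theorem Runs.seq {p q : Prog} {s : State} {Q R : ℕ → State → Prop} (hp : Runs p s R)
    (hq : ∀ t s', Frame p s s' → R t s' → Runs q s' fun t' => Q (t + t')) :
    Runs (.seq p q) s Q := by
  obtain ⟨t, s', h, hR⟩ := hp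
  obtain ⟨t', s'', h', hQ⟩ := hq t s' h.frame hR
  exact ⟨_, _, .seq h h', hQ⟩

theorem Runs.mono {p : Prog} {s : State} {Q R : ℕ → State → Prop} (hp : Runs p s R)
    (h : ∀ t s', Frame p s s' → R t s' → Q t s') : Runs p s Q := by
  obtain ⟨t, s', he, hR⟩ := hp
  exact ⟨t, s', he, h t s' he.frame hR⟩

theorem runs_of_loopFree {p : Prog} {s : State} {Q : ℕ → State → Prop} (hp : p.loopFree = true)
    (h : ∀ t ≤ p.wcost, Q t (p.run s)) : Runs p s Q := by
  obtain ⟨t, ht, he⟩ := exec_run hp s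
  exact ⟨t, _, he, h t ht⟩

/-- A loop-free prefix. -/
theorem Runs.seq_of_loopFree {p q : Prog} {s : State} {Q : ℕ → State → Prop}
    (hp : p.loopFree = true) (h : ∀ t ≤ p.wcost, Runs q (p.run s) fun t' => Q (t + t')) :
    Runs (.seq p q) s Q := by
  obtain ⟨t, ht, he⟩ := exec_run hp s
  obtain ⟨t', s', he', hQ⟩ := h t ht
  exact ⟨_, s', .seq he he', hQ⟩

/-- While loops, with an invariant that may refer to the time spent so far. -/
theorem runs_loop {b : Test} {p : Prog} (I : ℕ → ℕ → State → Prop) (n : ℕ)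
    (hb : ∀ k τ s, k < n → I k τ s → b.eval s) (hn : ∀ τ s, I n τ s → ¬ b.eval s)
    (step : ∀ k τ s, k < n → I k τ s → Runs p s fun t => I (k + 1) (τ + (b.cost + 1 + t)))
    (s : State) (h0 : I 0 0 s) :
    Runs (.loop b p) s fun t s' => ∃ τ, t = τ + (b.cost + 1) ∧ I n τ s' := by
  have key : ∀ d k τ s, k + d = n → I k τ s →
      Runs (.loop b p) s fun t s' => ∃ τ', τ + t = τ' + (b.cost + 1) ∧ I n τ' s' := by
    intro d
    induction d with
    | zero =>
      intro k τ s hk hI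
      obtain rfl : k = n := hk
      exact ⟨_, s, .loopFalse (hn _ _ hI), τ, rfl, hI⟩
    | succ d ih =>
      intro k τ s hk hI
      obtain ⟨t, s', he, hI'⟩ := step k τ s (by omega) hI
      obtain ⟨t', s'', he', τ', ht, hI''⟩ := ih (k + 1) _ s' (by omega) hI'
      exact ⟨_, s'', .loopTrue (hb _ _ _ (by omega) hI) he he', τ', by omega, hI''⟩
  simpa using key n 0 0 s (by simp) h0

/-- `for v < r do body`, where `v` and `r` are registers. -/
def forLoop (v r : ℕ) (body : Prog) : Prog :=
  .seq (.setN v (.const 0)) (.loop (.not (.nle (.reg r) (.reg v)))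
    (.seq body (.setN v (.add (.reg v) (.const 1)))))

/-- The time `τ` seen by the invariant is that of the bodies only. Test and increment cost 9 per
iteration; the initial assignment and the failing last test cost 7. An invariant that mentions `τ`
permits amortised bounds, which `color_spec` needs. -/
theorem runs_forLoop_time {v r : ℕ} {body : Prog} (I : ℕ → ℕ → State → Prop) {n : ℕ} {s₀ : State}
    (hr : s₀.nreg r = n) (hvr : r ≠ v) (hv : v ∉ body.nregs) (hr' : r ∉ body.nregs)
    (h0 : I 0 0 (s₀.setN v 0))
    (step : ∀ k τ s, k < n → Frame (forLoop v r body) s₀ s → s.nreg v = k → I k τ s →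
      Runs body s fun t s' => I (k + 1) (τ + t) (s'.setN v (k + 1))) :
    Runs (forLoop v r body) s₀ fun t s' => ∃ τ, t = τ + 9 * n + 7 ∧ I n τ s' := by
  set F := forLoop v r body with hF
  have hrF : r ∉ F.nregs := by
    simp [hF, forLoop, Prog.nregs, hvr, hr']
  have hset : ∀ s k, Frame F s (s.setN v k) := fun s k =>
    ⟨fun w hw => Function.update_of_ne (by rintro rfl; simp [hF, forLoop, Prog.nregs] at hw) _ _,
      fun _ _ => rfl, fun _ _ => rfl, fun _ _ => rfl⟩
  have hbody : ∀ s s', Frame body s s' → Frame F s s' := fun s s' h =>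
    h.mono (by intro x hx; simp [hF, forLoop, Prog.nregs, hx])
      (by intro x hx; simp [hF, forLoop, Prog.rregs, hx])
      (by intro x hx; simp [hF, forLoop, Prog.narrs, hx])
      (by intro x hx; simp [hF, forLoop, Prog.rarrs, hx])
  have hl := runs_loop (b := .not (.nle (.reg r) (.reg v)))
    (p := .seq body (.setN v (.add (.reg v) (.const 1))))
    (fun k τ s => ∃ τ', τ = τ' + 9 * k ∧ I k τ' s ∧ Frame F s₀ s ∧ s.nreg v = k) n
    (by
      rintro k τ s hk ⟨τ', -, -, hf, hvk⟩
      simp only [Test.eval, NExp.eval, hf.nreg r hrF, hr, hvk]; omega)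
    (by
      rintro τ s ⟨τ', -, -, hf, hvk⟩
      simp only [Test.eval, NExp.eval, hf.nreg r hrF, hr, hvk]; omega)
    (by
      rintro k τ s hk ⟨τ', rfl, hI, hf, hvk⟩
      obtain ⟨t, s', he, hI'⟩ := step k τ' s hk hf hvk hI
      have hvs' : s'.nreg v = k := (he.frame.nreg v hv).trans hvk
      refine ⟨_, _, .seq he (.setN v _ s'), τ' + t, ?_, ?_, ?_, ?_⟩
      · simp [Test.cost, NExp.cost]; ring
      · simpa [NExp.eval, hvs', State.setN] using hI'
      · exact (hf.trans (hbody _ _ he.frame)).trans (hset _ _)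
      · simp [NExp.eval, hvs'])
    (s₀.setN v 0) ⟨0, rfl, h0, hset _ _, by simp [State.setN]⟩
  obtain ⟨t, s', he, τ, rfl, τ', rfl, hI, -, -⟩ := hl
  exact ⟨_, s', .seq (.setN v (.const 0) s₀) he, τ', by simp [Test.cost, NExp.cost]; ring, hI⟩

theorem runs_forLoop {v r : ℕ} {body : Prog} (I : ℕ → State → Prop) {n : ℕ} (T : ℕ) {s₀ : State}
    (hr : s₀.nreg r = n) (hvr : r ≠ v) (hv : v ∉ body.nregs) (hr' : r ∉ body.nregs)
    (h0 : I 0 (s₀.setN v 0))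
    (step : ∀ k s, k < n → Frame (forLoop v r body) s₀ s → s.nreg v = k → I k s →
      Runs body s fun t s' => t ≤ T ∧ I (k + 1) (s'.setN v (k + 1))) :
    Runs (forLoop v r body) s₀ fun t s' => t ≤ (T + 9) * n + 7 ∧ I n s' := by
  refine (runs_forLoop_time (fun k τ s => τ ≤ T * k ∧ I k s) hr hvr hv hr' ⟨by simp, h0⟩ ?_).mono ?_
  · rintro k τ s hk hf hvk ⟨hτ, hI⟩
    refine (step k s hk hf hvk hI).mono ?_
    rintro t s' - ⟨ht, hI'⟩
    exact ⟨by rw [mul_add]; omega, hI'⟩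
  · rintro t s' - ⟨τ, rfl, hτ, hI⟩
    exact ⟨by rw [add_mul]; omega, hI⟩

end RealRAM

/-! ### Matchings of odd vertices and the signings compatible with them -/

namespace Rounding

/-- `M` is a partial matching on `V`, supported on the vertices `x` with `K (x - 1)` odd. The value
`0` means that a vertex is unmatched. -/
structure Pairing (K : ℕ → ℕ) (V : Set ℕ) (M : ℕ → ℕ) : Prop where
  zero : 0 ∉ V
  supp : ∀ x, M x ≠ 0 → x ∈ V
  odd : ∀ x, M x ≠ 0 → K (x - 1) % 2 = 1
  invol : ∀ x, M x ≠ 0 → M (M x) = x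
  irrefl : ∀ x, M x ≠ 0 → M x ≠ x

/-- `δ` is a function with values in `{-1, 0, 1}` that vanishes where `K` is even and takes opposite
values at matched vertices. -/
structure Signing (K M : ℕ → ℕ) (δ : ℕ → ℤ) : Prop where
  zero : δ 0 = 0
  abs_le : ∀ x, |δ x| ≤ 1
  even : ∀ x, K (x - 1) % 2 = 0 → δ x = 0
  neg : ∀ x, M x ≠ 0 → δ (M x) = -δ x

theorem Pairing.map_zero {K : ℕ → ℕ} {V : Set ℕ} {M : ℕ → ℕ} (h : Pairing K V M) : M 0 = 0 := by
  by_contra hh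
  exact h.zero (h.supp 0 hh)

theorem Pairing.mono {K : ℕ → ℕ} {V W : Set ℕ} {M : ℕ → ℕ} (h : Pairing K V M) (hVW : V ⊆ W)
    (hW : 0 ∉ W) : Pairing K W M :=
  ⟨hW, fun x hx => hVW (h.supp x hx), h.odd, h.invol, h.irrefl⟩

/-- Match the vertices `a` and `b`. -/
def link (M : ℕ → ℕ) (a b : ℕ) : ℕ → ℕ := Function.update (Function.update M a b) b a

theorem link_apply (M : ℕ → ℕ) (a b x : ℕ) :
    link M a b x = if x = b then a else if x = a then b else M x := by
  simp only [link, Function.update_apply]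

theorem Pairing.link {K : ℕ → ℕ} {V : Set ℕ} {M : ℕ → ℕ} (h : Pairing K V M) {a b : ℕ}
    (ha : a ∈ V) (hb : b ∈ V) (hab : a ≠ b) (hMa : M a = 0) (hMb : M b = 0)
    (hKa : K (a - 1) % 2 = 1) (hKb : K (b - 1) % 2 = 1) : Pairing K V (link M a b) := by
  have ha0 : a ≠ 0 := fun hh => h.zero (hh ▸ ha)
  have hb0 : b ≠ 0 := fun hh => h.zero (hh ▸ hb)
  have hz := h.map_zero
  have e := link_apply M a b
  refine ⟨h.zero, fun x hx => ?_, fun x hx => ?_, fun x hx => ?_, fun x hx => ?_⟩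
  · rw [e] at hx
    split_ifs at hx with h1 h2
    · exact h1 ▸ hb
    · exact h2 ▸ ha
    · exact h.supp x hx
  · rw [e] at hx
    split_ifs at hx with h1 h2
    · exact h1 ▸ hKb
    · exact h2 ▸ hKa
    · exact h.odd x hx
  · rw [e x] at hx ⊢
    split_ifs at hx ⊢ with h1 h2
    · rw [e]; simp [hab, h1]
    · rw [e]; simp [h2]
    -- Since `a` and `b` were unmatched, `M x = a` or `M x = b` would give `x = M (M x) = 0`.
    · have hi := h.invol x hx
      rw [e, if_neg, if_neg, hi]
      · rintro hh; rw [hh, hMa] at hi; exact hx (hi ▸ hz)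
      · rintro hh; rw [hh, hMb] at hi; exact hx (hi ▸ hz)
  · rw [e x] at hx ⊢
    split_ifs at hx ⊢ with h1 h2
    · rw [h1]; exact hab
    · rw [h2]; exact hab.symm
    · exact h.irrefl x hx

/-- A new edge only shrinks the set of compatible signings, so identities valid for all signings of
an earlier matching survive the rest of the sweep. -/
theorem Signing.of_link {K M : ℕ → ℕ} {δ : ℕ → ℤ} {a b : ℕ} (h : Signing K (link M a b) δ)
    (hMa : M a = 0) (hMb : M b = 0) : Signing K M δ := by
  refine ⟨h.zero, h.abs_le, h.even, fun x hx => ?_⟩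
  have e : link M a b x = M x := by
    rw [link_apply, if_neg, if_neg]
    · rintro rfl; exact hx hMa
    · rintro rfl; exact hx hMb
  have := h.neg x (by rwa [e])
  rwa [e] at this

theorem Signing.link_eq {K M : ℕ → ℕ} {δ : ℕ → ℤ} {a b : ℕ} (h : Signing K (link M a b) δ)
    (ha : a ≠ 0) : δ a = -δ b := by
  have e : link M a b b = a := by simp [link_apply]
  have := h.neg b (by rwa [e])
  rwa [e] at this

/-- The state of the sequential pairing procedure: `p` is the unmatched vertex of the current
segment and `t` the unmatched vertex among the leftovers of the previous segments (`0` if there is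
none). For all compatible signings, `F` and `G` are the sums over the current segment and over the
previous segments. -/
structure Sweep (K : ℕ → ℕ) (V : Set ℕ) (M : ℕ → ℕ) (p t : ℕ) (F G : (ℕ → ℤ) → ℤ) : Prop where
  pairing : Pairing K V M
  pend : p ≠ 0 → p ∈ V ∧ M p = 0 ∧ K (p - 1) % 2 = 1
  left : t ≠ 0 → t ∈ V ∧ M t = 0 ∧ K (t - 1) % 2 = 1
  ne : p ≠ 0 → p ≠ t
  cur : ∀ δ, Signing K M δ → F δ = δ p
  prev : ∀ δ, Signing K M δ → G δ = δ t

/-- Three cases for a vertex appended to the current segment: an even one contributes 0, a first odd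
one becomes pending, and a second odd one is linked to the pending vertex and cancels it. -/
theorem Sweep.push_even {K : ℕ → ℕ} {V : Set ℕ} {M : ℕ → ℕ} {p t : ℕ} {F G : (ℕ → ℤ) → ℤ}
    (h : Sweep K V M p t F G) {x : ℕ} (hx0 : x ≠ 0) (hx : K (x - 1) % 2 = 0) :
    Sweep K (insert x V) M p t (fun δ => F δ + δ x) G where
  pairing := h.pairing.mono (Set.subset_insert _ _) (by simp [hx0.symm, h.pairing.zero])
  pend hp := ⟨Set.mem_insert_of_mem _ (h.pend hp).1, (h.pend hp).2⟩
  left hp := ⟨Set.mem_insert_of_mem _ (h.left hp).1, (h.left hp).2⟩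
  ne := h.ne
  cur δ hδ := by rw [hδ.even x hx, add_zero, h.cur δ hδ]
  prev := h.prev

theorem Sweep.push_first {K : ℕ → ℕ} {V : Set ℕ} {M : ℕ → ℕ} {t : ℕ} {F G : (ℕ → ℤ) → ℤ}
    (h : Sweep K V M 0 t F G) {x : ℕ} (hx0 : x ≠ 0) (hxV : x ∉ V) (hx : K (x - 1) % 2 = 1) :
    Sweep K (insert x V) M x t (fun δ => F δ + δ x) G where
  pairing := h.pairing.mono (Set.subset_insert _ _) (by simp [hx0.symm, h.pairing.zero])
  pend _ := ⟨Set.mem_insert _ _, by by_contra hh; exact hxV (h.pairing.supp x hh), hx⟩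
  left hp := ⟨Set.mem_insert_of_mem _ (h.left hp).1, (h.left hp).2⟩
  ne _ hxt := by subst hxt; exact hxV (h.left hx0).1
  cur δ hδ := by rw [h.cur δ hδ, hδ.zero, zero_add]
  prev := h.prev

theorem Sweep.push_second {K : ℕ → ℕ} {V : Set ℕ} {M : ℕ → ℕ} {p t : ℕ} {F G : (ℕ → ℤ) → ℤ}
    (h : Sweep K V M p t F G) (hp : p ≠ 0) {x : ℕ} (hx0 : x ≠ 0) (hxV : x ∉ V)
    (hx : K (x - 1) % 2 = 1) :
    Sweep K (insert x V) (link M x p) 0 t (fun δ => F δ + δ x) G := by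
  have hMx : M x = 0 := by by_contra hh; exact hxV (h.pairing.supp x hh)
  obtain ⟨hpV, hMp, hKp⟩ := h.pend hp
  have hxp : x ≠ p := by rintro rfl; exact hxV hpV
  refine ⟨?_, fun hh => absurd rfl hh, fun ht => ?_, fun hh => absurd rfl hh, fun δ hδ => ?_,
    fun δ hδ => h.prev δ (hδ.of_link hMx hMp)⟩
  · exact (h.pairing.mono (Set.subset_insert _ _) (by simp [hx0.symm, h.pairing.zero])).link
      (Set.mem_insert _ _) (Set.mem_insert_of_mem _ hpV) hxp hMx hMp hx hKp
  · obtain ⟨h1, h2, h3⟩ := h.left ht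
    refine ⟨Set.mem_insert_of_mem _ h1, ?_, h3⟩
    rw [link_apply, if_neg (h.ne hp).symm, if_neg, h2]
    rintro rfl; exact hxV h1
  · rw [h.cur δ (hδ.of_link hMx hMp), hδ.link_eq hx0, hδ.zero]; ring

/-- At the end of a line the pending vertex joins the leftovers: it waits there, or is linked to the
one already waiting. Thus the sum over all closed lines is again the sign of at most one vertex. -/
theorem Sweep.close_first {K : ℕ → ℕ} {V : Set ℕ} {M : ℕ → ℕ} {p : ℕ} {F G : (ℕ → ℤ) → ℤ}
    (h : Sweep K V M p 0 F G) :
    Sweep K V M 0 p (fun _ => 0) (fun δ => G δ + F δ) where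
  pairing := h.pairing
  pend hh := absurd rfl hh
  left := h.pend
  ne hh := absurd rfl hh
  cur δ hδ := hδ.zero.symm
  prev δ hδ := by rw [h.cur δ hδ, h.prev δ hδ, hδ.zero, zero_add]

theorem Sweep.close_none {K : ℕ → ℕ} {V : Set ℕ} {M : ℕ → ℕ} {t : ℕ} {F G : (ℕ → ℤ) → ℤ}
    (h : Sweep K V M 0 t F G) :
    Sweep K V M 0 t (fun _ => 0) (fun δ => G δ + F δ) where
  pairing := h.pairing
  pend hh := absurd rfl hh
  left := h.left
  ne hh := absurd rfl hh
  cur δ hδ := hδ.zero.symm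
  prev δ hδ := by rw [h.cur δ hδ, h.prev δ hδ, hδ.zero, add_zero]

theorem Sweep.close_second {K : ℕ → ℕ} {V : Set ℕ} {M : ℕ → ℕ} {p t : ℕ} {F G : (ℕ → ℤ) → ℤ}
    (h : Sweep K V M p t F G) (hp : p ≠ 0) (ht : t ≠ 0) :
    Sweep K V (link M p t) 0 0 (fun _ => 0) (fun δ => G δ + F δ) := by
  obtain ⟨hpV, hMp, hKp⟩ := h.pend hp
  obtain ⟨htV, hMt, hKt⟩ := h.left ht
  refine ⟨h.pairing.link hpV htV (h.ne hp) hMp hMt hKp hKt, fun hh => absurd rfl hh,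
    fun hh => absurd rfl hh, fun hh => absurd rfl hh, fun δ hδ => hδ.zero.symm, fun δ hδ => ?_⟩
  rw [h.cur δ (hδ.of_link hMp hMt), h.prev δ (hδ.of_link hMp hMt), hδ.link_eq hp, hδ.zero]; ring

/-! ### Two-colouring the union of two matchings by alternating walks -/

/-- All edges of the matching `M` have two coloured ends of different colours, or two uncoloured
ends. -/
def Proper (M col : ℕ → ℕ) : Prop :=
  ∀ x, M x ≠ 0 → col x ≠ 0 → col (M x) ≠ 0 ∧ col (M x) ≠ col x

/-- The state of a walk that colours alternately with `a` and `b` along the edges of two matchings: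
`c` is the next vertex to be coloured, and `s` is the first vertex of the walk. -/
structure Walk (A B : ℕ → ℕ) (a b s : ℕ) (col : ℕ → ℕ) (c : ℕ) : Prop where
  zero : col 0 ≠ 0
  le_two : ∀ x, x ≠ 0 → col x ≤ 2
  proper : Proper A col
  edge : ∀ x, B x ≠ 0 → col x ≠ 0 → (col (B x) ≠ 0 ∧ col (B x) ≠ col x) ∨
    (col (B x) = 0 ∧ (B x = c ∧ col x = b ∨ x = s ∧ col x = a))
  next : col c = 0 → c = s ∨ (B c ≠ 0 ∧ col (B c) = b)

/-- Colour `c` and its partner in `A`. -/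
def paint (A : ℕ → ℕ) (a b : ℕ) (col : ℕ → ℕ) (c : ℕ) : ℕ → ℕ :=
  Function.update (Function.update col c a) (A c) b

/-- Every `B`-edge is traversed from a vertex of colour `b` to one of colour `a`. So the edge by
which `c` was entered becomes proper, and a new open edge can start only at `A c`, or at `c` when
`c` is the start `s`. If the walk closes up, it meets the open edge at `s`, of colour `a`, through
`A c`, of colour `b`. When `c` has no `A`-partner, `b` is written at the sentinel 0, which is never
uncoloured and so stops the walk. -/
theorem Walk.step {K : ℕ → ℕ} {V W : Set ℕ} {A B : ℕ → ℕ} (hA : Pairing K V A)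
    (hB : Pairing K W B) {a b s : ℕ} {col : ℕ → ℕ} {c : ℕ} (h : Walk A B a b s col c)
    (hab : a ≠ b) (ha : a ≠ 0) (hb : b ≠ 0) (ha2 : a ≤ 2) (hb2 : b ≤ 2) (hc : col c = 0) :
    Walk A B a b s (paint A a b col c) (B (A c)) := by
  have hc0 : c ≠ 0 := by rintro rfl; exact h.zero hc
  have hA0 := hA.map_zero
  have hB0 := hB.map_zero
  have hAc : A c ≠ c := by
    intro hh; exact hA.irrefl c (by rw [hh]; exact hc0) hh
  have e : ∀ x, paint A a b col c x = if x = A c then b else if x = c then a else col x := by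
    intro x; simp only [paint, Function.update_apply]
  have ec : paint A a b col c c = a := by rw [e, if_neg (Ne.symm hAc), if_pos rfl]
  have ew : paint A a b col c (A c) = b := by rw [e, if_pos rfl]
  have eo : ∀ x, x ≠ A c → x ≠ c → paint A a b col c x = col x := by
    intro x h1 h2; rw [e, if_neg h1, if_neg h2]
  -- `A`-edges are always coloured as a whole, so the partner of an uncoloured vertex is uncoloured.
  have hw : A c ≠ 0 → col (A c) = 0 := by
    intro h1; by_contra h2
    have := (h.proper (A c) (by rw [hA.invol c h1]; exact hc0) h2).1
    rw [hA.invol c h1] at this; exact this hc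
  have nz : ∀ x, col x ≠ 0 → paint A a b col c x ≠ 0 := by
    intro x hx; rw [e]; split_ifs <;> assumption
  refine ⟨nz 0 h.zero, ?_, ?_, ?_, ?_⟩
  · intro x hx; rw [e]; split_ifs
    · exact hb2
    · exact ha2
    · exact h.le_two x hx
  · intro x hx hcx
    by_cases h1 : x = A c
    · have hAc0 : A c ≠ 0 := by rintro h2; rw [h1, h2, hA0] at hx; exact hx rfl
      rw [h1, hA.invol c hAc0, ec, ew]; exact ⟨ha, hab⟩
    by_cases h2 : x = c
    · rw [h2, ec, ew]; exact ⟨hb, hab.symm⟩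
    rw [eo x h1 h2] at hcx ⊢
    have h3 : A x ≠ A c := by
      intro hh; exact h2 (by rw [← hA.invol x hx, hh, hA.invol c (hh ▸ hx)])
    have h4 : A x ≠ c := by rintro hh; exact h1 (by rw [← hh, hA.invol x hx])
    rw [eo _ h3 h4]; exact h.proper x hx hcx
  · intro x hx hcx
    have hBx := hB.invol x hx
    have hx0 : x ≠ 0 := by rintro rfl; exact hx hB0
    by_cases h1 : x = A c
    · have hAc0 : A c ≠ 0 := h1 ▸ hx0
      subst h1
      rw [ew]
      by_cases h2 : B (A c) = c
      · left; rw [h2, ec]; exact ⟨ha, hab⟩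
      have h3 : B (A c) ≠ A c := hB.irrefl _ hx
      rw [eo _ h3 h2]
      by_cases h4 : col (B (A c)) = 0
      · right; exact ⟨h4, .inl ⟨rfl, rfl⟩⟩
      · left; refine ⟨h4, ?_⟩
        rcases h.edge (B (A c)) (by rw [hBx]; exact hx0) h4 with h5 | ⟨-, h5 | h5⟩
        · rw [hBx] at h5; exact absurd (hw hAc0) h5.1
        · rw [hBx] at h5; exact absurd h5.1 hAc
        · rw [h5.2]; exact hab
    by_cases h2 : x = c
    · subst h2
      rw [ec]
      by_cases h3 : B x = A x
      · left; rw [h3, ew]; exact ⟨hb, hab.symm⟩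
      have h4 : B x ≠ x := hB.irrefl _ hx
      rw [eo _ h3 h4]
      rcases h.next hc with h5 | h5
      · by_cases h6 : col (B x) = 0
        · right; exact ⟨h6, .inr ⟨h5, rfl⟩⟩
        · left; refine ⟨h6, ?_⟩
          rcases h.edge (B x) (by rw [hBx]; exact hx0) h6 with h7 | ⟨-, h7 | h7⟩
          · rw [hBx] at h7; exact absurd hc h7.1
          · rw [h7.2]; exact hab.symm
          · exact absurd (h7.1.trans h5.symm) h4
      · left; rw [h5.2]; exact ⟨hb, hab.symm⟩
    rw [eo x h1 h2] at hcx ⊢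
    rcases h.edge x hx hcx with h3 | ⟨h3, h4⟩
    · left
      have h4 : B x ≠ c := by rintro hh; rw [hh] at h3; exact h3.1 hc
      have h5 : B x ≠ A c := by
        rintro hh; rw [hh] at h3 hx; exact h3.1 (hw hx)
      rw [eo _ h5 h4]; exact h3
    · by_cases h5 : B x = c
      · left; rw [h5, ec]; refine ⟨ha, ?_⟩
        rcases h4 with h4 | h4
        · rw [h4.2]; exact hab
        · rcases h.next hc with h6 | h6
          · rw [h6, ← h4.1] at hc; exact absurd hc hcx
          · rw [← h5, hBx] at h6; rw [h6.2]; exact hab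
      · have h4' := h4.resolve_left fun hh => h5 hh.1
        by_cases h6 : B x = A c
        · left; rw [h6, ew]; exact ⟨hb, by rw [h4'.2]; exact hab.symm⟩
        · right; rw [eo _ h6 h5]; exact ⟨h3, .inr h4'⟩
  · intro h1
    by_cases h2 : B (A c) = 0
    · rw [h2] at h1; exact absurd h1 (nz 0 h.zero)
    · right
      have h3 : A c ≠ 0 := by rintro hh; rw [hh, hB0] at h2; exact h2 rfl
      rw [hB.invol _ h2, ew]; exact ⟨h3, rfl⟩

/-- A partial colouring that is proper for both matchings. -/
structure Coloring (A B col : ℕ → ℕ) : Prop where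
  zero : col 0 ≠ 0
  le_two : ∀ x, x ≠ 0 → col x ≤ 2
  properA : Proper A col
  properB : Proper B col

theorem Coloring.walk {A B col : ℕ → ℕ} (h : Coloring A B col) (a b s : ℕ) :
    Walk A B a b s col s :=
  ⟨h.zero, h.le_two, h.properA, fun x hx hcx => .inl (h.properB x hx hcx), fun _ => .inl rfl⟩

/-- After the first walk stops, the only `B`-edge that may still be open is the one at `s`. As `s`
has colour `a`, the walk from `B s` exchanges the two colours. It leaves no open edge at its own
start, which is expressed by taking the sentinel 0 as start vertex. -/
theorem Walk.turn {K : ℕ → ℕ} {W : Set ℕ} {A B : ℕ → ℕ} (hB : Pairing K W B) {a b s : ℕ}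
    {col : ℕ → ℕ} {c : ℕ} (h : Walk A B a b s col c) (hc : col c ≠ 0) (hs : col s ≠ 0) :
    Walk A B b a 0 col (B s) := by
  refine ⟨h.zero, h.le_two, h.proper, fun x hx hcx => ?_, fun h1 => ?_⟩
  · rcases h.edge x hx hcx with h1 | ⟨h1, h2 | h2⟩
    · exact .inl h1
    · rw [h2.1] at h1; exact absurd h1 hc
    · exact .inr ⟨h1, .inl ⟨by rw [h2.1], h2.2⟩⟩
  · have h2 : B s ≠ 0 := by rintro hh; rw [hh] at h1; exact h.zero h1
    right
    rw [hB.invol s h2]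
    refine ⟨fun hh => h2 (by rw [hh, hB.map_zero]), ?_⟩
    rcases h.edge s h2 hs with h3 | ⟨-, h3 | h3⟩
    · exact absurd h1 h3.1
    · rw [h3.1] at h1; exact absurd h1 hc
    · exact h3.2

theorem Walk.coloring {K : ℕ → ℕ} {W : Set ℕ} {A B : ℕ → ℕ} (hB : Pairing K W B) {a b : ℕ}
    {col : ℕ → ℕ} {c : ℕ} (h : Walk A B a b 0 col c) (hc : col c ≠ 0) : Coloring A B col := by
  refine ⟨h.zero, h.le_two, h.proper, fun x hx hcx => ?_⟩
  rcases h.edge x hx hcx with h1 | ⟨h1, h2 | h2⟩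
  · exact h1
  · rw [h2.1] at h1; exact absurd h1 hc
  · rw [h2.1, hB.map_zero] at hx; exact absurd rfl hx

end Rounding

namespace RealRAM

theorem run_frame {p : Prog} (hp : p.loopFree = true) (s : State) : Frame p s (p.run s) := by
  obtain ⟨t, -, he⟩ := exec_run hp s
  exact he.frame

end RealRAM

/-! ### The program -/

namespace Rounding

open RealRAM

/-- Register `2` becomes the number of matrix entries. -/
def countEntries : Prog := forLoop 8 0 (.setN 2 (.add (.reg 2) (.reg 1)))

/-- Registers `5`, `6`, `7` become `2N`, `1`, `3N`, where `N` is the number of entries. -/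
def setConstants : Prog :=
  .seq (.setN 5 (.add (.reg 2) (.reg 2))) <| .seq (.setN 6 (.const 1)) <|
    .seq (.setN 7 (.add (.reg 2) (.reg 5))) (.setN 3 (.const 1))

/-- Register `3` becomes the least power `2 ^ t` greater than `2N`, and register `4` becomes `t`. -/
def findPower : Prog :=
  .loop (.nle (.reg 3) (.reg 5))
    (.seq (.setN 3 (.add (.reg 3) (.reg 3))) (.setN 4 (.add (.reg 4) (.const 1))))

/-- Array `1` becomes a table of `k ↦ k / 2`. -/
def halfTable : Prog :=
  forLoop 8 3 (.putN 1 (.add (.reg 8) (.const 2)) (.add (.get 1 (.reg 8)) (.const 1)))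

/-- One binary digit of real register `0` is moved to register `10`. -/
def digitStep : Prog :=
  .seq (.setR 0 (.add (.reg 0) (.reg 0))) <| .seq (.setN 10 (.add (.reg 10) (.reg 10))) <|
    .ite (.rle .one (.reg 0))
      (.seq (.setR 0 (.sub (.reg 0) .one)) (.setN 10 (.add (.reg 10) (.const 1)))) .skip

/-- Replace each entry `x` by the integral part (in array `0`) and the fractional part (in real
array `0`) of `2 ^ t x`. -/
def digits : Prog :=
  forLoop 8 2 <| .seq (.seq (.setR 0 (.get 0 (.reg 8))) (.setN 10 (.const 0))) <|
    .seq (forLoop 9 4 digitStep) <|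
      .seq (.putN 0 (.reg 8) (.reg 10)) (.putR 0 (.reg 8) (.reg 0))

/-- The body of `layout`. -/
def layoutStep (σ E inner is os db : ℕ) : Prog :=
  .seq (.putN σ (.reg 8) (.add (.reg 20) (.const 1))) <|
    .seq (.setR 1 (.add (.reg 1) (.get 0 (.reg 20)))) <|
    .seq (.ite (.rle .one (.reg 1))
      (.seq (.setR 1 (.sub (.reg 1) .one)) (.putN 0 (.add (.reg db) (.reg 8)) (.const 1)))
      (.putN 0 (.add (.reg db) (.reg 8)) (.const 0))) <|
    .seq (.setN 18 (.add (.reg 18) (.const 1))) <|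
    .seq (.setN 20 (.add (.reg 20) (.reg is))) <|
    .ite (.nle (.reg inner) (.reg 18))
      (.seq (.setN 18 (.const 0)) <| .seq (.setN 19 (.add (.reg 19) (.reg os))) <|
        .seq (.setN 20 (.reg 19)) (.putN E (.add (.reg 8) (.const 1)) (.const 1)))
      .skip

/-- List the entries line by line in array `σ`, mark the ends of lines in array `E`, and store the
carries of the fractional parts as weights of dummy entries. -/
def layout (σ E inner is os db : ℕ) : Prog :=
  .seq (.seq (.setN 18 (.const 0)) <| .seq (.setN 19 (.const 0)) <|
    .seq (.setN 20 (.const 0)) (.setR 1 .zero))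
    (forLoop 8 2 (layoutStep σ E inner is os db))

/-- Make both matchings and the colouring empty. -/
def clear : Prog :=
  .seq (.seq (.putN 4 (.const 0) (.const 0)) <| .seq (.putN 7 (.const 0) (.const 0))
    (.putN 8 (.const 0) (.const 1))) <|
  forLoop 8 7 <| .seq (.putN 4 (.add (.reg 8) (.const 1)) (.const 0)) <|
    .seq (.putN 7 (.add (.reg 8) (.const 1)) (.const 0))
      (.putN 8 (.add (.reg 8) (.const 1)) (.const 0))

/-- Test whether the weight at position `e` is odd. -/
def isOdd (e : NExp) : Test :=
  .not (.nle (.get 0 e) (.add (.get 1 (.get 0 e)) (.get 1 (.get 0 e))))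

/-- Match the vertex in register `x` with that in register `r`, or store it there. -/
def join (M x r : ℕ) : Prog :=
  .ite (.nle (.reg r) (.const 0)) (.setN r (.reg x))
    (.seq (.putN M (.reg x) (.reg r)) <| .seq (.putN M (.reg r) (.reg x)) (.setN r (.const 0)))

/-- Treat the vertex in register `12`. -/
def visit (M : ℕ) : Prog :=
  .ite (isOdd (.sub (.reg 12) (.const 1))) (join M 12 10) .skip

/-- Treat the end of a line. -/
def close (M : ℕ) : Prog :=
  .ite (.nle (.const 1) (.reg 10)) (.seq (join M 10 11) (.setN 10 (.const 0))) .skip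

/-- The body of `sweep`. -/
def sweepStep (σ E M db : ℕ) : Prog :=
  .seq (.setN 12 (.get σ (.reg 8))) <| .seq (visit M) <|
    .seq (.setN 12 (.add (.add (.reg db) (.reg 8)) (.const 1))) <| .seq (visit M) <|
    .ite (.nle (.const 1) (.get E (.add (.reg 8) (.const 1)))) (close M) .skip

/-- Match the vertices of odd weight: consecutive ones in each line, and then the leftovers. -/
def sweep (σ E M db : ℕ) : Prog :=
  .seq (.seq (.setN 10 (.const 0)) (.setN 11 (.const 0))) (forLoop 8 2 (sweepStep σ E M db))

/-- The body of `walk`. -/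
def walkStep (a b : ℕ) : Prog :=
  .seq (.putN 8 (.reg 13) (.const a)) <| .seq (.setN 14 (.get 4 (.reg 13))) <|
    .seq (.putN 8 (.reg 14) (.const b)) (.setN 13 (.get 7 (.reg 14)))

/-- Colour alternately along a path of the union of both matchings. -/
def walk (a b : ℕ) : Prog := .loop (.nle (.get 8 (.reg 13)) (.const 0)) (walkStep a b)

/-- Colour the union of both matchings properly. -/
def color : Prog :=
  forLoop 8 7 <| .seq (.setN 13 (.add (.reg 8) (.const 1))) <| .seq (walk 1 2) <|
    .seq (.setN 13 (.get 7 (.add (.reg 8) (.const 1)))) (walk 2 1)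

/-- The body of `vote`. -/
def voteStep : Prog :=
  .ite (isOdd (.add (.reg 2) (.reg 8)))
    (.ite (.nle (.get 8 (.add (.add (.reg 2) (.reg 8)) (.const 1))) (.const 1))
      (.setN 15 (.add (.reg 15) (.const 1))) (.setN 16 (.add (.reg 16) (.const 1)))) .skip

/-- Register `17` becomes the colour that is less frequent among dummies of odd weight. -/
def vote : Prog :=
  .seq (.seq (.setN 15 (.const 0)) (.setN 16 (.const 0))) <| .seq (forLoop 8 5 voteStep)
    (.ite (.nle (.reg 15) (.reg 16)) (.setN 17 (.const 1)) (.setN 17 (.const 2)))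

/-- The body of `halve`. -/
def halveStep : Prog :=
  .ite (.and (isOdd (.reg 8))
      (.and (.nle (.get 8 (.add (.reg 8) (.const 1))) (.reg 17))
        (.nle (.reg 17) (.get 8 (.add (.reg 8) (.const 1))))))
    (.putN 0 (.reg 8) (.add (.get 1 (.get 0 (.reg 8))) (.const 1)))
    (.putN 0 (.reg 8) (.get 1 (.get 0 (.reg 8))))

/-- Halve all weights; odd ones are rounded up where the colour is that in register `17`. -/
def halve : Prog := forLoop 8 7 halveStep

/-- One round of the algorithm: all weights are halved with small errors on lines. -/
def round : Prog :=
  .seq clear <| .seq (sweep 2 3 4 2) <| .seq (sweep 5 6 7 5) <| .seq color <| .seq vote halve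

/-- The preparatory part of the algorithm. -/
def prepare : Prog :=
  .seq countEntries <| .seq setConstants <| .seq findPower <| .seq halfTable <| .seq digits <|
    .seq (layout 2 3 1 6 1 2) (layout 5 6 0 1 6 5)

/-- The rounding algorithm. -/
def roundingProgram : Prog := .seq prepare (forLoop 21 4 round)

/-! ### Preparation: constants, the halving table and binary digits -/

theorem countEntries_spec {m n : ℕ} {s : State} (h0 : s.nreg 0 = m) (h1 : s.nreg 1 = n)
    (h2 : s.nreg 2 = 0) :
    Runs countEntries s fun t s' => t ≤ 13 * m + 7 ∧ s'.nreg 2 = m * n := by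
  refine (runs_forLoop (fun k s' => s'.nreg 2 = k * n) 4 h0 (by decide) (by decide) (by decide)
    (by simp [State.setN, h2]) ?_)
  intro k s' hk hf hv hI
  refine runs_of_loopFree rfl fun t ht => ⟨ht.trans (by decide), ?_⟩
  have e1 := hf.nreg 1 (by decide)
  simp [State.setN, Prog.run, NExp.eval, hI, e1, h1]
  ring

theorem findPower_spec {D : ℕ} {s : State} (hD : 0 < D) (h3 : s.nreg 3 = 1) (h4 : s.nreg 4 = 0)
    (h5 : s.nreg 5 = D) :
    Runs findPower s fun t s' => t ≤ 12 * s'.nreg 4 + 4 ∧ s'.nreg 3 = 2 ^ s'.nreg 4 ∧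
      s'.nreg 4 = Nat.log 2 D + 1 := by
  have hlog : ∀ k, 2 ^ k ≤ D ↔ k < Nat.log 2 D + 1 := fun k => by
    rw [Nat.lt_succ_iff, Nat.le_log_iff_pow_le (by norm_num) (by omega)]
  refine (runs_loop (fun k τ s' => τ ≤ 12 * k ∧ s'.nreg 3 = 2 ^ k ∧ s'.nreg 4 = k ∧
    s'.nreg 5 = D) (Nat.log 2 D + 1) ?_ ?_ ?_ s ⟨le_rfl, h3, h4, h5⟩).mono ?_
  · rintro k τ s' hk ⟨-, e3, -, e5⟩
    simpa [Test.eval, NExp.eval, e3, e5, hlog] using hk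
  · rintro τ s' ⟨-, e3, -, e5⟩
    simp only [Test.eval, NExp.eval, e3, e5, hlog]; omega
  · rintro k τ s' hk ⟨hτ, e3, e4, e5⟩
    refine runs_of_loopFree rfl fun t ht => ⟨?_, ?_, ?_, ?_⟩
    · simp [Prog.wcost, NExp.cost] at ht; simp [Test.cost, NExp.cost]; omega
    · simp [Prog.run, NExp.eval, e3]; ring
    · simp [Prog.run, NExp.eval, e4]
    · simp [Prog.run, NExp.eval, e5]
  · rintro t s' - ⟨τ, rfl, hτ, e3, e4, e5⟩
    refine ⟨?_, by rw [e3, e4], e4⟩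
    simp [Test.cost, NExp.cost, e4]; omega

/-- The machine cannot divide; the table follows `(k + 2) / 2 = k / 2 + 1`, and the zero cells are
already right at 0 and 1. -/
theorem halfTable_spec {P : ℕ} {s : State} (h3 : s.nreg 3 = P) (h : ∀ k, s.narr 1 k = 0) :
    Runs halfTable s fun t s' => t ≤ 17 * P + 7 ∧ ∀ k < P + 2, s'.narr 1 k = k / 2 := by
  refine (runs_forLoop (fun k s' => ∀ j < k + 2, s'.narr 1 j = j / 2) 8 h3 (by decide) (by decide)
    (by decide) ?_ ?_)
  · intro j hj
    simp [State.setN, h]; omega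
  · intro k s' hk hf hv hI
    refine runs_of_loopFree rfl fun t ht => ⟨ht.trans (by decide), fun j hj => ?_⟩
    have e := hI k (by omega)
    simp only [State.setN, Prog.run, NExp.eval, hv, Function.update_self, e, Function.update_apply]
    split_ifs with hjk
    · omega
    · exact hI j (by omega)

/-- No floor operation is available. Doubling, comparing with 1 and subtracting yields one binary
digit at a time. -/
theorem digits_spec {N T : ℕ} {s : State} (h2 : s.nreg 2 = N) (h4 : s.nreg 4 = T)
    (hx : ∀ e < N, 0 ≤ s.rarr 0 e ∧ s.rarr 0 e < 1) :
    Runs digits s fun t s' => t ≤ (38 * T + 29) * N + 7 ∧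
      ∀ e < N, (s'.narr 0 e : ℝ) + s'.rarr 0 e = 2 ^ T * s.rarr 0 e ∧
        0 ≤ s'.rarr 0 e ∧ s'.rarr 0 e < 1 := by
  refine (runs_forLoop (fun k s' => (∀ e < k, (s'.narr 0 e : ℝ) + s'.rarr 0 e =
    2 ^ T * s.rarr 0 e ∧ 0 ≤ s'.rarr 0 e ∧ s'.rarr 0 e < 1) ∧ ∀ e, k ≤ e →
      s'.rarr 0 e = s.rarr 0 e) (38 * T + 20) h2 (by decide) (by decide) (by decide)
      ⟨by simp, fun _ _ => rfl⟩ ?_).mono ?_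
  · rintro k s' hk hf hv ⟨hI, hI'⟩
    have e4 : s'.nreg 4 = T := (hf.nreg 4 (by decide)).trans h4
    refine Runs.seq_of_loopFree rfl fun t₁ ht₁ => ?_
    have hz := hx k hk
    rw [← hI' k le_rfl] at hz
    refine Runs.seq (runs_forLoop (fun r s'' => (s''.nreg 10 : ℝ) + s''.rreg 0 =
        2 ^ r * s.rarr 0 k ∧ 0 ≤ s''.rreg 0 ∧ s''.rreg 0 < 1) 29 (n := T) ?_ (by decide) (by decide)
        (by decide) ?_ ?_) ?_
    · simp [Prog.run, e4]
    · simp [Prog.run, State.setN, NExp.eval, RExp.eval, hv, hI']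
      simpa [hI'] using hz
    · rintro r s'' hr hf' hv' ⟨i1, i2, i3⟩
      refine runs_of_loopFree rfl fun t ht => ⟨ht.trans (by decide), ?_⟩
      by_cases hb : (1 : ℝ) ≤ s''.rreg 0 + s''.rreg 0
      · simp [State.setN, Prog.run, NExp.eval, RExp.eval, Test.eval, digitStep, hb]
        refine ⟨?_, by linarith⟩
        rw [pow_succ]; linarith
      · simp [State.setN, Prog.run, NExp.eval, RExp.eval, Test.eval, digitStep, hb]
        refine ⟨?_, by linarith, by linarith⟩
        rw [pow_succ]; linarith
    · rintro t₂ s'' hf' ⟨ht₂, i1, i2, i3⟩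
      have ev : s''.nreg 8 = k := by
        rw [hf'.nreg 8 (by decide)]; simp [Prog.run, hv]
      have ea : s''.narr 0 = s'.narr 0 := hf'.narr 0 (by decide)
      have er : s''.rarr 0 = s'.rarr 0 := hf'.rarr 0 (by decide)
      refine runs_of_loopFree rfl fun t ht => ⟨?_, ?_, ?_⟩
      · simp [Prog.wcost, NExp.cost, RExp.cost] at ht ht₁; omega
      · intro e he
        simp only [State.setN, Prog.run, NExp.eval, RExp.eval, ev, ea, er, Function.update_self,
          Function.update_apply]
        split_ifs with hek
        · rw [hek]; exact ⟨i1, i2, i3⟩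
        · exact hI e (by omega)
      · intro e he
        have hek : e ≠ k := by omega
        simp only [State.setN, Prog.run, NExp.eval, RExp.eval, ev, ea, er, Function.update_self,
          Function.update_apply, if_neg hek]
        exact hI' e (by omega)
  · rintro t s' - ⟨ht, hI, -⟩
    exact ⟨ht, hI⟩

end Rounding

/-! ### Line orders and the carries of the fractional parts -/

namespace Rounding

open RealRAM

/-- The list `σ` of entries in line order (shifted by one), the marks `E` of line ends, and the
weights `K` of the dummies, which are the carries of the fractional parts `f`. -/
structure Layout (N inner is os db : ℕ) (f : ℕ → ℝ) (σ E K : ℕ → ℕ) : Prop where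
  entry : ∀ q < N, σ q = q / inner * os + q % inner * is + 1
  ends : ∀ q < N, 1 ≤ E (q + 1) ↔ (q + 1) % inner = 0
  carry : ∃ acc : ℕ → ℝ, (∀ q ≤ N, 0 ≤ acc q ∧ acc q < 1) ∧
    ∀ q < N, acc q + f (q / inner * os + q % inner * is) = acc (q + 1) + K (db + q)
  le_one : ∀ q < N, K (db + q) ≤ 1

/-- The program replaces division by counters; this is the update rule they obey. -/
theorem succ_div_mod {q inner : ℕ} (h : 0 < inner) :
    (inner ≤ q % inner + 1 → (q + 1) / inner = q / inner + 1 ∧ (q + 1) % inner = 0) ∧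
    (¬ inner ≤ q % inner + 1 → (q + 1) / inner = q / inner ∧ (q + 1) % inner = q % inner + 1) := by
  have h1 := Nat.div_add_mod q inner
  have h2 := Nat.mod_lt q h
  constructor
  · intro h3
    have h4 : q + 1 = inner * (q / inner + 1) := by rw [mul_add]; omega
    rw [h4]; simp [h]
  · intro h3
    have h4 : q + 1 = q % inner + 1 + inner * (q / inner) := by omega
    constructor
    · conv_lhs => rw [h4]
      rw [Nat.add_mul_div_left _ _ h, Nat.div_eq_of_lt (by omega)]; simp
    · conv_lhs => rw [h4]
      rw [Nat.add_mul_mod_self_left, Nat.mod_eq_of_lt (by omega)]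

theorem layout_spec {σ E inner is os db N : ℕ} {s : State} (hσ : σ ≠ 0) (hE : E ≠ 0) (hσE : σ ≠ E)
    (hinner : inner < 8) (his : is < 8) (hos : os < 8) (hdb : db < 8) (hpos : 0 < s.nreg inner)
    (h2 : s.nreg 2 = N) (hE0 : ∀ q, s.narr E q = 0)
    (hf01 : ∀ q < N, 0 ≤ s.rarr 0 (q / s.nreg inner * s.nreg os + q % s.nreg inner * s.nreg is) ∧
      s.rarr 0 (q / s.nreg inner * s.nreg os + q % s.nreg inner * s.nreg is) < 1) :
    Runs (layout σ E inner is os db) s fun t s' => t ≤ 66 * N + 20 ∧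
      Layout N (s.nreg inner) (s.nreg is) (s.nreg os) (s.nreg db) (s.rarr 0)
        (s'.narr σ) (s'.narr E) (s'.narr 0) ∧
      ∀ v, v < s.nreg db ∨ s.nreg db + N ≤ v → s'.narr 0 v = s.narr 0 v := by
  refine Runs.seq_of_loopFree rfl fun t₁ ht₁ => ?_
  set s₁ := Prog.run _ s with hs₁
  have r1 : ∀ v < 8, s₁.nreg v = s.nreg v := fun v hv => by
    have h18 : v ≠ 18 := by omega
    have h19 : v ≠ 19 := by omega
    have h20 : v ≠ 20 := by omega
    simp [hs₁, Prog.run, h18, h19, h20]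
  have ra : s₁.narr = s.narr := rfl
  have rr : s₁.rarr = s.rarr := rfl
  have e18 : s₁.nreg 18 = 0 := rfl
  have e19 : s₁.nreg 19 = 0 := rfl
  have e20 : s₁.nreg 20 = 0 := rfl
  have e1 : s₁.rreg 1 = 0 := rfl
  set b := s.nreg inner with hb
  set d := s.nreg db with hd
  set i1 := s.nreg is with hi1
  set o1 := s.nreg os with ho1
  -- The sequence `acc` is the history of real register 1. It is not reset between lines, so its
  -- differences control the whole order as well as parts of lines.
  refine (runs_forLoop (fun k s' => (s'.nreg 18 = k % b ∧ s'.nreg 19 = k / b * o1 ∧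
    s'.nreg 20 = k / b * o1 + k % b * i1) ∧
    (∀ q < k, s'.narr σ q = q / b * o1 + q % b * i1 + 1) ∧
    ((∀ q < k, 1 ≤ s'.narr E (q + 1) ↔ (q + 1) % b = 0) ∧
      ∀ q, k ≤ q → s'.narr E (q + 1) = 0) ∧
    (∃ acc : ℕ → ℝ, (∀ q ≤ k, 0 ≤ acc q ∧ acc q < 1) ∧ acc k = s'.rreg 1 ∧
      ∀ q < k, acc q + s.rarr 0 (q / b * o1 + q % b * i1) =
        acc (q + 1) + s'.narr 0 (d + q)) ∧
    (∀ q < k, s'.narr 0 (d + q) ≤ 1) ∧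
    ∀ v, v < d ∨ d + k ≤ v → s'.narr 0 v = s.narr 0 v) 57 (n := N) ?_ (by decide) ?_ ?_ ?_ ?_).mono
    ?_
  · rw [r1 2 (by norm_num), h2]
  · simp [layoutStep, Prog.nregs]
  · simp [layoutStep, Prog.nregs]
  · refine ⟨by simp [State.setN, e18, e19, e20], by simp, ⟨by simp, ?_⟩,
      ⟨fun _ => 0, by simp, by simp [State.setN, e1], by simp⟩, by simp, ?_⟩
    · intro q _; simp [State.setN, ra, hE0]
    · intro v _; simp [State.setN, ra]
  · rintro k s' hk hf hv ⟨⟨i18, i19, i20⟩, iσ, ⟨iE, iE'⟩, ⟨acc, hacc, hacck, hrec⟩, hle, hK⟩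
    have reg : ∀ v < 8, s'.nreg v = s.nreg v := fun v hv' => by
      rw [hf.nreg v, r1 v hv']
      simp [forLoop, layoutStep, Prog.nregs]; omega
    have rrr : s'.rarr 0 = s.rarr 0 := by
      rw [hf.rarr 0 (by simp [forLoop, layoutStep, Prog.rarrs]), rr]
    have einner := reg inner hinner
    have eis := reg is his
    have eos := reg os hos
    have edb := reg db hdb
    rw [← hb] at einner
    rw [← hi1] at eis
    rw [← ho1] at eos
    rw [← hd] at edb
    have n1 : inner ≠ 18 := by omega
    have n1' : inner ≠ 20 := by omega
    have n2 : is ≠ 18 := by omega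
    have n3 : os ≠ 18 := by omega
    have n3' : os ≠ 20 := by omega
    refine runs_of_loopFree rfl fun t ht => ⟨ht.trans (by
      simp [layoutStep, Prog.wcost, NExp.cost, RExp.cost, Test.cost]), ?_⟩
    obtain ⟨hw1, hw2⟩ := succ_div_mod (q := k) hpos
    set x := k / b * o1 + k % b * i1 with hx
    have hk0 := hacc k le_rfl
    set w : ℕ := if 1 ≤ s'.rreg 1 + s.rarr 0 x then 1 else 0 with hw
    set a' : ℝ := s'.rreg 1 + s.rarr 0 x - w with ha'
    set u := ((layoutStep σ E inner is os db).run s').setN 8 (k + 1) with hu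
    have hfx := hf01 k hk
    have comp : u.narr σ = Function.update (s'.narr σ) k (x + 1) ∧
        u.narr 0 = Function.update (s'.narr 0) (d + k) w ∧
        u.narr E = (if b ≤ k % b + 1 then Function.update (s'.narr E) (k + 1) 1
          else s'.narr E) ∧ u.rreg 1 = a' ∧
        u.nreg 18 = (if b ≤ k % b + 1 then 0 else k % b + 1) ∧
        u.nreg 19 = (if b ≤ k % b + 1 then k / b * o1 + o1 else k / b * o1) ∧
        u.nreg 20 = (if b ≤ k % b + 1 then k / b * o1 + o1 else x + i1) := by
      by_cases c1 : 1 ≤ s'.rreg 1 + s.rarr 0 x <;> by_cases c2 : b ≤ k % b + 1 <;>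
      simp [hu, State.setN, layoutStep, Prog.run, NExp.eval, RExp.eval, Test.eval, i18, i19, i20,
        rrr, hv, c1, c2, einner, eis, eos, edb, n1, n1', n2, n3, n3', hσ, hE, hσE, hσ.symm, hE.symm,
        hσE.symm, hw, ha']
    obtain ⟨uσ, u0, uE, ur, u18, u19, u20⟩ := comp
    -- Two numbers in `[0, 1)` have a sum below 2, so a carry of 0 or 1 suffices.
    have ha01 : 0 ≤ a' ∧ a' < 1 := by
      rw [hacck] at hk0
      by_cases c1 : 1 ≤ s'.rreg 1 + s.rarr 0 x
      · simp only [ha', hw, if_pos c1]; push_cast; constructor <;> linarith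
      · simp only [ha', hw, if_neg c1]; push_cast; constructor <;> linarith
    have hw1' : w ≤ 1 := by rw [hw]; split_ifs <;> simp
    refine ⟨⟨?_, ?_, ?_⟩, ?_, ⟨?_, ?_⟩, ?_, ?_, ?_⟩
    · rw [u18]; split_ifs with c
      · exact (hw1 c).2.symm
      · exact (hw2 c).2.symm
    · rw [u19]; split_ifs with c
      · rw [(hw1 c).1]; ring
      · rw [(hw2 c).1]
    · rw [u20]; split_ifs with c
      · rw [(hw1 c).1, (hw1 c).2]; ring
      · rw [(hw2 c).1, (hw2 c).2, hx]; ring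
    · intro q hq
      rw [uσ, Function.update_apply]
      split_ifs with c
      · rw [c]
      · exact iσ q (by omega)
    · intro q hq
      rw [uE]
      by_cases c : q = k
      · subst c
        split_ifs with c'
        · simp [(hw1 c').2]
        · rw [iE' q le_rfl, (hw2 c').2]; simp
      · rw [← iE q (by omega)]
        split_ifs with c'
        · rw [Function.update_of_ne (by omega)]
        · rfl
    · intro q hq
      rw [uE]
      split_ifs with c'
      · rw [Function.update_of_ne (by omega)]; exact iE' q (by omega)
      · exact iE' q (by omega)
    · refine ⟨Function.update acc (k + 1) a', ?_, ?_, ?_⟩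
      · intro q hq
        rw [Function.update_apply]; split_ifs with c
        · exact ha01
        · exact hacc q (by omega)
      · rw [ur]; simp
      · intro q hq
        rw [u0, Function.update_of_ne (by omega)]
        by_cases c : q = k
        · subst c; simp only [Function.update_self, hacck, ← hx, ha']; ring
        · rw [Function.update_of_ne (by omega), Function.update_of_ne (by omega)]
          exact hrec q (by omega)
    · intro q hq
      rw [u0, Function.update_apply]; split_ifs with c
      · exact hw1'
      · exact hle q (by omega)
    · intro v hv'
      rw [u0, Function.update_of_ne (by omega)]; exact hK v (by omega)
  · rintro t s' - ⟨ht, -, hσ', ⟨hE', -⟩, ⟨acc, hacc, -, hrec⟩, hle, hK⟩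
    refine ⟨?_, ⟨hσ', hE', ⟨acc, hacc, hrec⟩, hle⟩, hK⟩
    simp [Prog.wcost, NExp.cost, RExp.cost] at ht₁; omega

end Rounding

/-! ### The sweep that matches odd vertices along a line order -/

namespace Rounding

open RealRAM

/-- Sum over the entries and dummies at positions `a ≤ q < b` of a line order. -/
def seg (σ : ℕ → ℕ) (d : ℕ) (δ : ℕ → ℤ) (a b : ℕ) : ℤ :=
  ∑ q ∈ Finset.Ico a b, (δ (σ q) + δ (d + q + 1))

/-- All initial segments of lines, and the whole sequence, have small sum. -/
def Balanced (N inner : ℕ) (σ : ℕ → ℕ) (d : ℕ) (δ : ℕ → ℤ) : Prop :=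
  (∀ q < N, |seg σ d δ (q / inner * inner) (q + 1)| ≤ 1) ∧ |seg σ d δ 0 N| ≤ 1

theorem isOdd_eval {s : State} {e : NExp}
    (h : s.narr 1 (s.narr 0 (e.eval s)) = s.narr 0 (e.eval s) / 2) :
    (isOdd e).eval s ↔ s.narr 0 (e.eval s) % 2 = 1 := by
  simp only [isOdd, Test.eval, NExp.eval, h]; omega

/-- The second clause makes bounds proved for the old matching available to the signings of the new
one. -/
theorem visit_spec {M x : ℕ} {s : State} {V : Set ℕ} {F G : (ℕ → ℤ) → ℤ}
    (h12 : s.nreg 12 = x) (hx0 : x ≠ 0) (hxV : x ∉ V)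
    (hhalf : s.narr 1 (s.narr 0 (x - 1)) = s.narr 0 (x - 1) / 2)
    (h : Sweep (s.narr 0) V (s.narr M) (s.nreg 10) (s.nreg 11) F G) :
    Sweep (s.narr 0) (insert x V) (((visit M).run s).narr M) (((visit M).run s).nreg 10)
      (s.nreg 11) (fun δ => F δ + δ x) G ∧
    ∀ δ, Signing (s.narr 0) (((visit M).run s).narr M) δ → Signing (s.narr 0) (s.narr M) δ := by
  have hodd : (isOdd (.sub (.reg 12) (.const 1))).eval s ↔ s.narr 0 (x - 1) % 2 = 1 := by
    have := isOdd_eval (s := s) (e := .sub (.reg 12) (.const 1)) (by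
      simpa [NExp.eval, h12] using hhalf)
    simpa [NExp.eval, h12] using this
  by_cases c : s.narr 0 (x - 1) % 2 = 1
  · by_cases c' : s.nreg 10 = 0
    · have e1 : ((visit M).run s).narr M = s.narr M := by
        simp [visit, join, Prog.run, hodd, c, Test.eval, NExp.eval, c']
      have e2 : ((visit M).run s).nreg 10 = x := by
        simp [visit, join, Prog.run, hodd, c, Test.eval, NExp.eval, c', h12]
      rw [e1, e2]
      rw [c'] at h
      exact ⟨h.push_first hx0 hxV c, fun _ hδ => hδ⟩
    · have e1 : ((visit M).run s).narr M = link (s.narr M) x (s.nreg 10) := by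
        simp [visit, join, Prog.run, hodd, c, Test.eval, NExp.eval, c', h12, link]
      have e2 : ((visit M).run s).nreg 10 = 0 := by
        simp [visit, join, Prog.run, hodd, c, Test.eval, NExp.eval, c', h12]
      rw [e1, e2]
      exact ⟨h.push_second c' hx0 hxV c, fun _ hδ => hδ.of_link
        (by by_contra hh; exact hxV (h.pairing.supp x hh)) (h.pend c').2.1⟩
  · have e1 : (visit M).run s = s := by simp [visit, Prog.run, hodd, c]
    rw [e1]
    exact ⟨h.push_even hx0 (by omega), fun _ hδ => hδ⟩

theorem close_spec {M : ℕ} {s : State} {V : Set ℕ} {K : ℕ → ℕ} {F G : (ℕ → ℤ) → ℤ}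
    (h : Sweep K V (s.narr M) (s.nreg 10) (s.nreg 11) F G) :
    Sweep K V (((close M).run s).narr M) (((close M).run s).nreg 10)
      (((close M).run s).nreg 11) (fun _ => 0) (fun δ => G δ + F δ) ∧
    ∀ δ, Signing K (((close M).run s).narr M) δ → Signing K (s.narr M) δ := by
  by_cases c : s.nreg 10 = 0
  · have e1 : (close M).run s = s := by simp [close, Prog.run, Test.eval, NExp.eval, c]
    rw [e1, c]
    rw [c] at h
    exact ⟨h.close_none, fun _ hδ => hδ⟩
  · have c0 : 1 ≤ s.nreg 10 := by omega
    by_cases c' : s.nreg 11 = 0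
    · have e1 : ((close M).run s).narr M = s.narr M := by
        simp [close, join, Prog.run, Test.eval, NExp.eval, c', c0]
      have e2 : ((close M).run s).nreg 10 = 0 := by
        simp [close, join, Prog.run, Test.eval, NExp.eval, c', c0]
      have e3 : ((close M).run s).nreg 11 = s.nreg 10 := by
        simp [close, join, Prog.run, Test.eval, NExp.eval, c', c0]
      rw [e1, e2, e3]
      rw [c'] at h
      exact ⟨h.close_first, fun _ hδ => hδ⟩
    · have e1 : ((close M).run s).narr M = link (s.narr M) (s.nreg 10) (s.nreg 11) := by
        simp [close, join, Prog.run, Test.eval, NExp.eval, c', c0, link]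
      have e2 : ((close M).run s).nreg 10 = 0 := by
        simp [close, join, Prog.run, Test.eval, NExp.eval, c', c0]
      have e3 : ((close M).run s).nreg 11 = 0 := by
        simp [close, join, Prog.run, Test.eval, NExp.eval, c', c0]
      rw [e1, e2, e3]
      exact ⟨h.close_second c c', fun _ hδ => hδ.of_link (h.pend c).2.1 (h.left c').2.1⟩

/-- The vertices at the first `k` positions of a line order. -/
def visited (σ : ℕ → ℕ) (d k : ℕ) : Set ℕ := {x | ∃ q < k, x = σ q ∨ x = d + q + 1}

theorem visited_succ (σ : ℕ → ℕ) (d k : ℕ) :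
    insert (d + k + 1) (insert (σ k) (visited σ d k)) = visited σ d (k + 1) := by
  ext x
  simp only [visited, Set.mem_insert_iff, Set.mem_ofPred_eq]
  constructor
  · rintro (h | h | ⟨q, hq, h⟩)
    · exact ⟨k, by omega, .inr h⟩
    · exact ⟨k, by omega, .inl h⟩
    · exact ⟨q, by omega, h⟩
  · rintro ⟨q, hq, h⟩
    by_cases c : q = k
    · subst c; tauto
    · exact .inr (.inr ⟨q, by omega, h⟩)

theorem seg_succ (σ : ℕ → ℕ) (d : ℕ) (δ : ℕ → ℤ) {a b : ℕ} (h : a ≤ b) :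
    seg σ d δ a (b + 1) = seg σ d δ a b + δ (σ b) + δ (d + b + 1) := by
  rw [seg, Finset.sum_Ico_succ_top h, ← seg]; ring

theorem seg_add (σ : ℕ → ℕ) (d : ℕ) (δ : ℕ → ℤ) {a b c : ℕ} (h : a ≤ b) (h' : b ≤ c) :
    seg σ d δ a b + seg σ d δ b c = seg σ d δ a c :=
  Finset.sum_Ico_consecutive _ h h'

/-- The balance is claimed for all compatible signings, because the actual one is known only after
both matchings have been built and coloured together. -/
theorem sweep_spec {σ E M db N inner d : ℕ} {s : State} (hM0 : M ≠ 0) (hM1 : M ≠ 1) (hMσ : M ≠ σ)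
    (hME : M ≠ E) (hdb : db < 8) (h2 : s.nreg 2 = N) (hd : s.nreg db = d) (hNd : N ≤ d)
    (hpos : 0 < inner) (hdvd : inner ∣ N)
    (hσ0 : ∀ q < N, s.narr σ q ≠ 0) (hσN : ∀ q < N, s.narr σ q ≤ N)
    (hinj : ∀ q < N, ∀ q' < N, s.narr σ q = s.narr σ q' → q = q')
    (hE : ∀ q < N, 1 ≤ s.narr E (q + 1) ↔ (q + 1) % inner = 0)
    (hhalf : ∀ v < d + N, s.narr 1 (s.narr 0 v) = s.narr 0 v / 2)
    (hM : ∀ x, s.narr M x = 0) :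
    Runs (sweep σ E M db) s fun t s' => t ≤ 120 * N + 20 ∧
      Pairing (s.narr 0) (Set.Icc 1 (d + N)) (s'.narr M) ∧
      ∀ δ, Signing (s.narr 0) (s'.narr M) δ → Balanced N inner (s.narr σ) d δ := by
  refine Runs.seq_of_loopFree rfl fun t₁ ht₁ => ?_
  set s₁ := Prog.run _ s with hs₁
  have r1 : ∀ v < 8, s₁.nreg v = s.nreg v := fun v hv => by
    have h18 : v ≠ 10 := by omega
    have h19 : v ≠ 11 := by omega
    simp [hs₁, Prog.run, h18, h19]
  have ra : s₁.narr = s.narr := rfl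
  set K := s.narr 0 with hK
  set S := s.narr σ with hS
  refine (runs_forLoop (fun k s' =>
    Sweep K (visited S d k) (s'.narr M) (s'.nreg 10) (s'.nreg 11)
      (fun δ => seg S d δ (k / inner * inner) k) (fun δ => seg S d δ 0 (k / inner * inner)) ∧
    ∀ δ, Signing K (s'.narr M) δ → ∀ q < k, |seg S d δ (q / inner * inner) (q + 1)| ≤ 1)
    111 (n := N) ?_ (by decide) ?_ ?_ ?_ ?_).mono ?_
  · rw [r1 2 (by norm_num), h2]
  · simp [sweepStep, visit, close, join, Prog.nregs]
  · simp [sweepStep, visit, close, join, Prog.nregs]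
  · have e10 : s₁.nreg 10 = 0 := rfl
    have e11 : s₁.nreg 11 = 0 := rfl
    refine ⟨⟨⟨by simp [visited], ?_, ?_, ?_, ?_⟩, ?_, ?_, ?_, ?_, ?_⟩, by simp⟩ <;>
      simp [State.setN, ra, hM, e10, e11, seg]
    · exact fun δ hδ => hδ.zero.symm
    · exact fun δ hδ => hδ.zero.symm
  · rintro k s' hk hf hv ⟨hI, hB⟩
    have hle : k / inner * inner ≤ k := Nat.div_mul_le_self k inner
    have reg : ∀ v < 8, s'.nreg v = s.nreg v := fun v hv' => by
      rw [hf.nreg v, r1 v hv']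
      simp [forLoop, sweepStep, visit, close, join, Prog.nregs]; omega
    have arr : ∀ a, a ≠ M → s'.narr a = s.narr a := fun a ha => by
      rw [hf.narr a (by simp [forLoop, sweepStep, visit, close, join, Prog.narrs, ha]), ra]
    have a0 : s'.narr 0 = K := arr 0 hM0.symm
    have fv : ∀ u, Frame (visit M) u ((visit M).run u) := fun u => run_frame rfl u
    have nv : ∀ v, v ≠ 10 → v ≠ 12 → v ∉ (visit M).nregs := fun v h1 h2 => by
      simp [visit, join, Prog.nregs, h1]
    have av : ∀ a, a ≠ M → a ∉ (visit M).narrs := fun a ha => by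
      simp [visit, join, Prog.narrs, ha]
    -- Entries have numbers at most `N ≤ d`, dummies of this order have numbers above `d`, and `S`
    -- is injective, so no vertex is met twice.
    have hnew : ∀ x, x = S k ∨ x = d + k + 1 → x ∉ visited S d k := by
      rintro x hx ⟨q, hq, hx'⟩
      have hq' := hσN q (by omega)
      have hk' := hσN k hk
      rcases hx with rfl | rfl <;> rcases hx' with hx' | hx'
      · have := hinj k hk q (by omega) hx'; omega
      · omega
      · omega
      · omega
    set u₁ := (Prog.setN 12 (.get σ (.reg 8))).run s' with hu₁
    set u₂ := (visit M).run u₁ with hu₂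
    set u₃ := (Prog.setN 12 (.add (.add (.reg db) (.reg 8)) (.const 1))).run u₂ with hu₃
    set u₄ := (visit M).run u₃ with hu₄
    have b1 : u₁.narr = s'.narr := rfl
    have b12 : u₁.nreg 12 = S k := by
      simp [hu₁, Prog.run, NExp.eval, hv, arr σ hMσ.symm, hS]
    have o12 : ∀ v, v ≠ 12 → u₁.nreg v = s'.nreg v := fun v h => by
      simp [hu₁, Prog.run, h]
    have a1 : s'.narr 1 = s.narr 1 := arr 1 hM1.symm
    have step1 := visit_spec (M := M) (x := S k) (s := u₁) (V := visited S d k)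
      (F := fun δ => seg S d δ (k / inner * inner) k)
      (G := fun δ => seg S d δ 0 (k / inner * inner)) b12 (hσ0 k hk) (hnew _ (.inl rfl))
      (by
        have := hσN k hk
        have := hσ0 k hk
        rw [b1, a0, a1]; exact hhalf _ (by omega))
      (by rw [b1, a0, o12 10 (by decide), o12 11 (by decide)]; exact hI)
    rw [← hu₂, b1, a0, o12 11 (by decide)] at step1
    have c0 : ∀ a, a ≠ M → u₂.narr a = s.narr a := fun a ha => by
      rw [hu₂, (fv u₁).narr a (av a ha), b1, arr a ha]
    have cr : ∀ v, v ≠ 10 → v ≠ 12 → u₂.nreg v = s'.nreg v := fun v h1 h2 => by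
      rw [hu₂, (fv u₁).nreg v (nv v h1 h2), o12 v h2]
    have d1 : u₃.narr = u₂.narr := rfl
    have d12 : u₃.nreg 12 = d + k + 1 := by
      simp only [hu₃, Prog.run, NExp.eval, Function.update_self]
      rw [cr db (by omega) (by omega), cr 8 (by decide) (by decide), hv, reg db hdb, hd]
    have od : ∀ v, v ≠ 12 → u₃.nreg v = u₂.nreg v := fun v h => by
      simp [hu₃, Prog.run, h]
    have step2 := visit_spec (M := M) (x := d + k + 1) (s := u₃)
      (V := insert (S k) (visited S d k))
      (F := fun δ => seg S d δ (k / inner * inner) k + δ (S k))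
      (G := fun δ => seg S d δ 0 (k / inner * inner)) d12 (by omega)
      (by
        have := hσN k hk
        rw [Set.mem_insert_iff, not_or]
        exact ⟨by omega, hnew _ (.inr rfl)⟩)
      (by rw [d1, c0 0 hM0.symm, c0 1 hM1.symm]; exact hhalf _ (by omega))
      (by
        rw [d1, c0 0 hM0.symm, od 10 (by decide), od 11 (by decide), cr 11 (by decide) (by decide)]
        exact step1.1)
    rw [← hu₄, d1, c0 0 hM0.symm, od 11 (by decide), cr 11 (by decide) (by decide),
      visited_succ] at step2
    have e0 : ∀ a, a ≠ M → u₄.narr a = s.narr a := fun a ha => by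
      rw [hu₄, (fv u₃).narr a (av a ha), d1, c0 a ha]
    have er : ∀ v, v ≠ 10 → v ≠ 12 → u₄.nreg v = s'.nreg v := fun v h1 h2 => by
      rw [hu₄, (fv u₃).nreg v (nv v h1 h2), od v h2, cr v h1 h2]
    obtain ⟨st1, si1⟩ := step1
    obtain ⟨st2, si2⟩ := step2
    have hseg : ∀ δ, seg S d δ (k / inner * inner) k + δ (S k) + δ (d + k + 1) =
        seg S d δ (k / inner * inner) (k + 1) := fun δ => (seg_succ S d δ hle).symm
    simp only [hseg] at st2
    -- Once both vertices at position `k` are treated, the sum over the current line so far is the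
    -- sign of the pending vertex, or 0.
    have hB' : ∀ δ, Signing K (u₄.narr M) δ →
        ∀ q < k + 1, |seg S d δ (q / inner * inner) (q + 1)| ≤ 1 := by
      intro δ hδ q hq
      by_cases c : q = k
      · subst c
        have := st2.cur δ hδ
        rw [this]; exact hδ.abs_le _
      · exact hB δ (si1 δ (si2 δ hδ)) q (by omega)
    refine runs_of_loopFree rfl fun t ht => ⟨ht.trans (by
      simp [sweepStep, visit, close, join, isOdd, Prog.wcost, NExp.cost, Test.cost]), ?_⟩
    have hend : Test.eval u₄ (.nle (.const 1) (.get E (.add (.reg 8) (.const 1)))) ↔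
        (k + 1) % inner = 0 := by
      simp only [Test.eval, NExp.eval]
      rw [e0 E hME.symm, er 8 (by decide) (by decide), hv]; exact hE k hk
    obtain ⟨hw1, hw2⟩ := succ_div_mod (q := k) hpos
    have hm := Nat.mod_lt k hpos
    have hrun : (sweepStep σ E M db).run s' =
        (Prog.ite (.nle (.const 1) (.get E (.add (.reg 8) (.const 1)))) (close M) .skip).run u₄ :=
      rfl
    rw [hrun]
    by_cases c : inner ≤ k % inner + 1
    · rw [← er 11 (by decide) (by decide)] at st2
      obtain ⟨hcl, hcl'⟩ := close_spec st2
      have hr : (Prog.ite (.nle (.const 1) (.get E (.add (.reg 8) (.const 1)))) (close M)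
          .skip).run u₄ = (close M).run u₄ := by
        rw [Prog.run, if_pos (hend.2 (hw1 c).2)]
      rw [hr]
      have hdv : (k + 1) / inner * inner = k + 1 :=
        Nat.div_mul_cancel (Nat.dvd_of_mod_eq_zero (hw1 c).2)
      have hs1 : (fun δ => seg S d δ ((k + 1) / inner * inner) (k + 1)) = fun _ => 0 := by
        funext δ; rw [hdv]; simp [seg]
      have hs2 : (fun δ => seg S d δ 0 ((k + 1) / inner * inner)) = fun δ =>
          seg S d δ 0 (k / inner * inner) + seg S d δ (k / inner * inner) (k + 1) := by
        funext δ; rw [hdv, seg_add S d δ (Nat.zero_le _) (by omega)]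
      rw [hs1, hs2]
      exact ⟨hcl, fun δ hδ => hB' δ (hcl' δ hδ)⟩
    · have hr : (Prog.ite (.nle (.const 1) (.get E (.add (.reg 8) (.const 1)))) (close M)
          .skip).run u₄ = u₄ := by
        rw [Prog.run, if_neg (fun hh => ?_), Prog.run]
        have := hend.1 hh
        rw [(hw2 c).2] at this; omega
      rw [← er 11 (by decide) (by decide)] at st2
      rw [hr, (hw2 c).1]
      exact ⟨st2, hB'⟩
  · rintro t s' - ⟨ht, hI, hB⟩
    refine ⟨?_, hI.pairing.mono ?_ (by simp), fun δ hδ => ⟨hB δ hδ, ?_⟩⟩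
    · simp [Prog.wcost, NExp.cost] at ht₁; omega
    · rintro x ⟨q, hq, rfl | rfl⟩
      · have := hσN q hq
        have := hσ0 q hq
        exact ⟨by omega, by omega⟩
      · exact ⟨by omega, by omega⟩
    -- Lines fill the order exactly, so at the end everything is closed and the total is the sign of
    -- the last leftover.
    · have := hI.prev δ hδ
      simp only [Nat.div_mul_cancel hdvd] at this
      rw [this]; exact hδ.abs_le _

end Rounding

/-! ### Colouring, choice of the colour to round up, and halving -/

namespace Rounding

open RealRAM

theorem clear_spec {L : ℕ} {s : State} (h7 : s.nreg 7 = L) (hA : ∀ x, L < x → s.narr 4 x = 0)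
    (hB : ∀ x, L < x → s.narr 7 x = 0) (hC : ∀ x, L < x → s.narr 8 x ≤ 2) :
    Runs clear s fun t s' => t ≤ 24 * L + 16 ∧ (∀ x, s'.narr 4 x = 0) ∧ (∀ x, s'.narr 7 x = 0) ∧
      s'.narr 8 0 ≠ 0 ∧ (∀ x, 1 ≤ x → x ≤ L → s'.narr 8 x = 0) ∧
      ∀ x, L < x → s'.narr 8 x ≤ 2 := by
  refine Runs.seq_of_loopFree rfl fun t₁ ht₁ => ?_
  refine (runs_forLoop (fun k s' => (∀ x, x ≤ k ∨ L < x → s'.narr 4 x = 0) ∧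
    (∀ x, x ≤ k ∨ L < x → s'.narr 7 x = 0) ∧ s'.narr 8 0 ≠ 0 ∧
      (∀ x, 1 ≤ x → x ≤ k → s'.narr 8 x = 0) ∧ ∀ x, L < x → s'.narr 8 x ≤ 2) 15
      (n := L) ?_ (by decide) (by decide) (by decide) ?_ ?_).mono ?_
  · exact h7
  · simp only [State.setN, Prog.run, NExp.eval]
    refine ⟨fun x hx => ?_, fun x hx => ?_, by simp, fun x h1 h2 => by omega, fun x hx => ?_⟩
    · rcases hx with hx | hx
      · simp [Nat.le_zero.1 hx]
      · simp [hA x hx, Function.update_apply]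
    · rcases hx with hx | hx
      · simp [Nat.le_zero.1 hx]
      · simp [hB x hx, Function.update_apply]
    · have := hC x hx
      have hx0 : x ≠ 0 := by omega
      simpa [hx0] using this
  · rintro k s' hk hf hv ⟨i4, i7, i8, i8', i8''⟩
    refine runs_of_loopFree rfl fun t ht => ⟨ht.trans (by decide), ?_⟩
    have key : ∀ (f : ℕ → ℕ) x, (x ≠ k + 1 → f x = 0) →
        Function.update f (k + 1) 0 x = 0 := fun f x hx => by
      rw [Function.update_apply]; split_ifs with c
      · rfl
      · exact hx c
    simp only [State.setN, Prog.run, NExp.eval, hv]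
    refine ⟨fun x hx => ?_, fun x hx => ?_, ?_, fun x h1 h2 => ?_, fun x hx => ?_⟩
    · simpa using key _ x fun c => i4 x (by omega)
    · simpa using key _ x fun c => i7 x (by omega)
    · simpa using i8
    · simpa using key _ x fun c => i8' x h1 (by omega)
    · have hx0 : x ≠ k + 1 := by omega
      simpa [hx0] using i8'' x hx
  · rintro t s' - ⟨ht, i4, i7, i8, i8', i8''⟩
    refine ⟨?_, fun x => i4 x (by omega), fun x => i7 x (by omega), i8, i8', i8''⟩
    simp [Prog.wcost, NExp.cost] at ht₁; omega

/-- The number of uncoloured vertices. -/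
def uncolored (L : ℕ) (col : ℕ → ℕ) : ℕ := ((Finset.Icc 1 L).filter fun x => col x = 0).card

theorem paint_ne_zero {A : ℕ → ℕ} {a b : ℕ} {col : ℕ → ℕ} {c : ℕ} (ha : a ≠ 0) (hb : b ≠ 0) {x : ℕ}
    (hx : col x ≠ 0) : paint A a b col c x ≠ 0 := by
  simp only [paint, Function.update_apply]; split_ifs <;> assumption

theorem paint_self_ne_zero {A : ℕ → ℕ} {a b : ℕ} {col : ℕ → ℕ} {c : ℕ} (ha : a ≠ 0) (hb : b ≠ 0) :
    paint A a b col c c ≠ 0 := by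
  simp only [paint, Function.update_apply]; split_ifs <;> assumption

theorem uncolored_paint_lt {A : ℕ → ℕ} {a b L : ℕ} {col : ℕ → ℕ} {c : ℕ} (ha : a ≠ 0) (hb : b ≠ 0)
    (hc : col c = 0) (h1 : 1 ≤ c) (hL : c ≤ L) :
    uncolored L (paint A a b col c) < uncolored L col := by
  refine Finset.card_lt_card ⟨fun x hx => ?_, fun hh => ?_⟩
  · rw [Finset.mem_filter] at hx ⊢
    refine ⟨hx.1, ?_⟩
    by_contra h; exact paint_ne_zero ha hb h hx.2
  · have := hh (Finset.mem_filter.2 ⟨Finset.mem_Icc.2 ⟨h1, hL⟩, hc⟩)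
    exact paint_self_ne_zero ha hb (Finset.mem_filter.1 this).2

theorem Pairing.apply_le {K : ℕ → ℕ} {L : ℕ} {B : ℕ → ℕ} (hB : Pairing K (Set.Icc 1 L) B) (x : ℕ) :
    B x ≤ L := by
  by_cases hz : B x = 0
  · omega
  · have h1 := hB.invol _ hz
    have h2 : B (B x) ≠ 0 := by
      rw [h1]; intro hh; rw [hh, hB.map_zero] at hz; exact hz rfl
    exact (hB.supp _ h2).2

/-- Each turn of the loop costs at most 17 and colours at least one vertex, so the potential `17 *
uncolored` pays for it; the extra 5 is the failing test. The bound `U` on the number of uncoloured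
vertices drives the induction. -/
theorem walk_spec {K : ℕ → ℕ} {L : ℕ} {A B : ℕ → ℕ} (hA : Pairing K (Set.Icc 1 L) A)
    (hB : Pairing K (Set.Icc 1 L) B) {a b v : ℕ} (hab : a ≠ b) (ha : a ≠ 0) (hb : b ≠ 0)
    (ha2 : a ≤ 2) (hb2 : b ≤ 2) : ∀ (U : ℕ) (s : State), uncolored L (s.narr 8) ≤ U →
    s.narr 4 = A → s.narr 7 = B → s.nreg 13 ≤ L → Walk A B a b v (s.narr 8) (s.nreg 13) →
    Runs (walk a b) s fun t s' => t + 17 * uncolored L (s'.narr 8) ≤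
        17 * uncolored L (s.narr 8) + 5 ∧ Walk A B a b v (s'.narr 8) (s'.nreg 13) ∧
      s'.narr 8 (s'.nreg 13) ≠ 0 ∧ (∀ x, s.narr 8 x ≠ 0 → s'.narr 8 x ≠ 0) ∧
      s'.narr 8 (s.nreg 13) ≠ 0 := by
  intro U
  induction U with
  | zero =>
    intro s hU h4 h7 h13 hW
    by_cases hc : s.narr 8 (s.nreg 13) = 0
    · have h0 : s.nreg 13 ≠ 0 := fun hh => hW.zero (by rwa [hh] at hc)
      have := uncolored_paint_lt (A := A) ha hb hc (by omega) h13
      omega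
    · refine ⟨5, s, .loopFalse ?_, by omega, hW, hc, fun _ h => h, hc⟩
      simpa [Test.eval, NExp.eval] using hc
  | succ U ih =>
    intro s hU h4 h7 h13 hW
    by_cases hc : s.narr 8 (s.nreg 13) = 0
    · have h0 : s.nreg 13 ≠ 0 := fun hh => hW.zero (by rwa [hh] at hc)
      have hlt := uncolored_paint_lt (A := A) ha hb hc (by omega) h13
      obtain ⟨t, ht, he⟩ := exec_run (p := walkStep a b) rfl s
      set u := (walkStep a b).run s with hu
      have u4 : u.narr 4 = A := h4
      have u7 : u.narr 7 = B := h7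
      have u8 : u.narr 8 = paint A a b (s.narr 8) (s.nreg 13) := by
        simp [hu, walkStep, Prog.run, NExp.eval, paint, h4]
      have u13 : u.nreg 13 = B (A (s.nreg 13)) := by
        simp [hu, walkStep, Prog.run, NExp.eval, h4, h7]
      have hle : u.nreg 13 ≤ L := by
        rw [u13]; exact hB.apply_le _
      obtain ⟨t', s', he', ht', hW', hc', hx', -⟩ := ih u (by rw [u8]; omega) u4 u7 hle
        (by rw [u8, u13]; exact hW.step hA hB hab ha hb ha2 hb2 hc)
      refine ⟨_, s', .loopTrue ?_ he he', ?_, hW', hc', fun x hx => hx' x ?_, hx' _ ?_⟩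
      · simp [Test.eval, NExp.eval, hc]
      · simp [walkStep, Prog.wcost, NExp.cost] at ht
        rw [u8] at ht'
        simp [Test.cost, NExp.cost]; omega
      · rw [u8]; exact paint_ne_zero ha hb hx
      · rw [u8]; exact paint_self_ne_zero ha hb
    · refine ⟨5, s, .loopFalse ?_, by omega, hW, hc, fun _ h => h, hc⟩
      simpa [Test.eval, NExp.eval] using hc

theorem color_spec {K : ℕ → ℕ} {L : ℕ} {s : State} (hA : Pairing K (Set.Icc 1 L) (s.narr 4))
    (hB : Pairing K (Set.Icc 1 L) (s.narr 7)) (h7 : s.nreg 7 = L) (h80 : s.narr 8 0 ≠ 0)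
    (h8 : ∀ x, 1 ≤ x → x ≤ L → s.narr 8 x = 0) (h8' : ∀ x, L < x → s.narr 8 x ≤ 2) :
    Runs color s fun t s' => t ≤ 45 * L + 7 ∧ Coloring (s.narr 4) (s.narr 7) (s'.narr 8) ∧
      ∀ x, 1 ≤ x → x ≤ L → s'.narr 8 x ≠ 0 := by
  have hnot : ∀ {M : ℕ → ℕ}, Pairing K (Set.Icc 1 L) M → Proper M (s.narr 8) := by
    intro M hM x hx hx'
    obtain ⟨h1, h2⟩ := hM.supp x hx
    exact absurd (h8 x h1 h2) hx'
  -- Walk steps are charged to the potential, which starts at no more than `17 * L`. An iteration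
  -- costs 19 besides: 9 for the two assignments and 5 for each of the two failing tests.
  refine (runs_forLoop_time (fun k τ s' => τ + 17 * uncolored L (s'.narr 8) ≤ 17 * L + 19 * k ∧
    Coloring (s.narr 4) (s.narr 7) (s'.narr 8) ∧ ∀ x, 1 ≤ x → x ≤ k → s'.narr 8 x ≠ 0) (n := L)
    h7 (by decide) (by decide) (by decide) ?_ ?_).mono ?_
  · refine ⟨?_, ⟨h80, fun x hx => ?_, hnot hA, hnot hB⟩, fun x h1 h2 => by omega⟩
    · have : uncolored L (s.narr 8) ≤ L := by
        refine (Finset.card_filter_le _ _).trans ?_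
        simp
      simp only [State.setN]; omega
    · simp only [State.setN]
      by_cases c : x ≤ L
      · rw [h8 x (by omega) c]; omega
      · exact h8' x (by omega)
  · rintro k τ s' hk hf hv ⟨hτ, hC, hI⟩
    have e4 : s'.narr 4 = s.narr 4 := hf.narr 4 (by decide)
    have e7 : s'.narr 7 = s.narr 7 := hf.narr 7 (by decide)
    refine Runs.seq_of_loopFree rfl fun t₁ ht₁ => ?_
    set u₁ := Prog.run _ s' with hu₁
    have b4 : u₁.narr 4 = s.narr 4 := e4
    have b7 : u₁.narr 7 = s.narr 7 := e7
    have b8 : u₁.narr 8 = s'.narr 8 := rfl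
    have b13 : u₁.nreg 13 = k + 1 := by simp [hu₁, Prog.run, NExp.eval, hv]
    have bv : u₁.nreg 8 = k := hv
    refine Runs.seq (walk_spec hA hB (v := k + 1) (a := 1) (b := 2) (by decide) (by decide)
      (by decide) (by decide) (by decide) _ u₁ le_rfl b4 b7 (by omega)
      (by rw [b8, b13]; exact hC.walk 1 2 (k + 1))) ?_
    rintro t₂ u₂ hf₂ ⟨ht₂, hW, hc, hmono, hself⟩
    rw [b8] at ht₂ hmono
    rw [b13] at hself
    have c4 : u₂.narr 4 = s.narr 4 := (hf₂.narr 4 (by decide)).trans b4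
    have c7 : u₂.narr 7 = s.narr 7 := (hf₂.narr 7 (by decide)).trans b7
    have cv : u₂.nreg 8 = k := (hf₂.nreg 8 (by decide)).trans bv
    refine Runs.seq_of_loopFree rfl fun t₃ ht₃ => ?_
    set u₃ := Prog.run _ u₂ with hu₃
    have d4 : u₃.narr 4 = s.narr 4 := c4
    have d7 : u₃.narr 7 = s.narr 7 := c7
    have d8 : u₃.narr 8 = u₂.narr 8 := rfl
    have d13 : u₃.nreg 13 = s.narr 7 (k + 1) := by simp [hu₃, Prog.run, NExp.eval, cv, c7]
    refine (walk_spec hA hB (v := 0) (a := 2) (b := 1) (by decide) (by decide)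
      (by decide) (by decide) (by decide) _ u₃ le_rfl d4 d7 (by rw [d13]; exact hB.apply_le _)
      (by rw [d8, d13]; exact hW.turn hB hc hself)).mono ?_
    rintro t₄ u₄ - ⟨ht₄, hW', hc', hmono', -⟩
    rw [d8] at ht₄ hmono'
    refine ⟨?_, hW'.coloring hB hc', fun x h1 h2 => hmono' x ?_⟩
    · simp [Prog.wcost, NExp.cost] at ht₁ ht₃
      simp only [State.setN]; omega
    · by_cases c : x = k + 1
      · rw [c]; exact hself
      · exact hmono x (hI x h1 (by omega))
  · rintro t s' - ⟨τ, rfl, hτ, hC, hI⟩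
    exact ⟨by omega, hC, hI⟩

/-- The rounding direction of the vertex `x` if the vertices of colour `c` are rounded up. -/
def sgn (K col : ℕ → ℕ) (c x : ℕ) : ℤ :=
  if x ≠ 0 ∧ K (x - 1) % 2 = 1 then (if col x = c then 1 else -1) else 0

theorem signing_sgn {K col : ℕ → ℕ} {L c : ℕ} {M : ℕ → ℕ} (hM : Pairing K (Set.Icc 1 L) M)
    (hP : Proper M col) (hcol : ∀ x, 1 ≤ x → x ≤ L → col x = 1 ∨ col x = 2) (hc : c = 1 ∨ c = 2) :
    Signing K M (sgn K col c) := by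
  refine ⟨by simp [sgn], fun x => ?_, fun x hx => by simp [sgn, hx], fun x hx => ?_⟩
  · rw [sgn]; split_ifs <;> simp
  · obtain ⟨h1, h2⟩ := hM.supp x hx
    have hx' : M (M x) ≠ 0 := by rw [hM.invol x hx]; omega
    obtain ⟨h3, h4⟩ := hM.supp _ hx'
    have hcx := hcol x h1 h2
    have hcm := hcol (M x) h3 h4
    have hne := (hP x hx (by omega)).2
    have hx0 : x ≠ 0 := by omega
    have e1 : sgn K col c (M x) = if col (M x) = c then 1 else -1 := if_pos ⟨hx, hM.odd _ hx'⟩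
    have e2 : sgn K col c x = if col x = c then 1 else -1 := if_pos ⟨hx0, hM.odd x hx⟩
    rw [e1, e2]
    split_ifs <;> first | rfl | omega

/-- Exchanging the colours negates every sign, so one of the two choices makes the sum over the
dummies nonpositive. -/
theorem vote_spec {N D : ℕ} {s : State} (h2 : s.nreg 2 = N) (h5 : s.nreg 5 = D)
    (hhalf : ∀ v < N + D, s.narr 1 (s.narr 0 v) = s.narr 0 v / 2)
    (hcol : ∀ x, 1 ≤ x → x ≤ N + D → s.narr 8 x = 1 ∨ s.narr 8 x = 2) :
    Runs vote s fun t s' => t ≤ 45 * D + 20 ∧ (s'.nreg 17 = 1 ∨ s'.nreg 17 = 2) ∧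
      ∑ i ∈ Finset.range D, sgn (s.narr 0) (s.narr 8) (s'.nreg 17) (N + i + 1) ≤ 0 := by
  refine Runs.seq_of_loopFree rfl fun t₁ ht₁ => ?_
  set s₁ := Prog.run _ s with hs₁
  refine Runs.seq (runs_forLoop (fun k s' => (s'.nreg 15 : ℤ) - s'.nreg 16 =
    ∑ i ∈ Finset.range k, sgn (s.narr 0) (s.narr 8) 1 (N + i + 1)) 36 (n := D) h5 (by decide)
    (by decide) (by decide) ?_ ?_) ?_
  · simp [State.setN, hs₁, Prog.run, NExp.eval]
  · rintro k s' hk hf hv hI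
    have e0 : s'.narr 0 = s.narr 0 := hf.narr 0 (by decide)
    have e1 : s'.narr 1 = s.narr 1 := hf.narr 1 (by decide)
    have e8 : s'.narr 8 = s.narr 8 := hf.narr 8 (by decide)
    have e2 : s'.nreg 2 = N := (hf.nreg 2 (by decide)).trans h2
    refine runs_of_loopFree rfl fun t ht => ⟨ht.trans (by decide), ?_⟩
    have hodd : (isOdd (.add (.reg 2) (.reg 8))).eval s' ↔ s.narr 0 (N + k) % 2 = 1 := by
      have := isOdd_eval (s := s') (e := .add (.reg 2) (.reg 8)) (by
        simp only [NExp.eval, e0, e1, e2, hv]; exact hhalf _ (by omega))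
      simpa [NExp.eval, e0, e2, hv] using this
    have hc := hcol (N + k + 1) (by omega) (by omega)
    rw [Finset.sum_range_succ, ← hI]
    by_cases c : s.narr 0 (N + k) % 2 = 1
    · rcases hc with hc | hc
      · simp [State.setN, voteStep, Prog.run, hodd, c, Test.eval, NExp.eval, e8, e2, hv, hc, sgn]
        ring
      · simp [State.setN, voteStep, Prog.run, hodd, c, Test.eval, NExp.eval, e8, e2, hv, hc, sgn]
        ring
    · simp [State.setN, voteStep, Prog.run, hodd, c, sgn]
  · rintro t₂ s' hf ⟨ht₂, hI⟩
    refine runs_of_loopFree rfl fun t ht => ⟨?_, ?_⟩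
    · simp [Prog.wcost, NExp.cost, Test.cost] at ht ht₁; omega
    · by_cases c : s'.nreg 15 ≤ s'.nreg 16
      · have e17 : (Prog.run (.ite (.nle (.reg 15) (.reg 16)) (.setN 17 (.const 1))
          (.setN 17 (.const 2))) s').nreg 17 = 1 := by
          simp [Prog.run, Test.eval, NExp.eval, c]
        rw [e17, ← hI]
        exact ⟨.inl rfl, by omega⟩
      · have e17 : (Prog.run (.ite (.nle (.reg 15) (.reg 16)) (.setN 17 (.const 1))
          (.setN 17 (.const 2))) s').nreg 17 = 2 := by
          simp [Prog.run, Test.eval, NExp.eval, c]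
        rw [e17]
        refine ⟨.inr rfl, ?_⟩
        have : ∑ i ∈ Finset.range D, sgn (s.narr 0) (s.narr 8) 2 (N + i + 1) =
            -∑ i ∈ Finset.range D, sgn (s.narr 0) (s.narr 8) 1 (N + i + 1) := by
          rw [← Finset.sum_neg_distrib]
          refine Finset.sum_congr rfl fun i hi => ?_
          have hi' := Finset.mem_range.1 hi
          rcases hcol (N + i + 1) (by omega) (by omega) with hc | hc <;> simp [sgn, hc] <;>
            split_ifs <;> rfl
        rw [this, ← hI]; omega

theorem halve_spec {L : ℕ} {s : State} (h7 : s.nreg 7 = L)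
    (hhalf : ∀ v < L, s.narr 1 (s.narr 0 v) = s.narr 0 v / 2) :
    Runs halve s fun t s' => t ≤ 50 * L + 7 ∧
      ∀ v < L, 2 * (s'.narr 0 v : ℤ) = s.narr 0 v + sgn (s.narr 0) (s.narr 8) (s.nreg 17) (v + 1) := by
  refine (runs_forLoop (fun k s' => (∀ v < k, 2 * (s'.narr 0 v : ℤ) =
    s.narr 0 v + sgn (s.narr 0) (s.narr 8) (s.nreg 17) (v + 1)) ∧
      ∀ v, k ≤ v → s'.narr 0 v = s.narr 0 v) 41 (n := L) h7 (by decide)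
    (by decide) (by decide) ⟨by simp, fun _ _ => rfl⟩ ?_).mono ?_
  · rintro k s' hk hf hv ⟨hI, hI'⟩
    have e1 : s'.narr 1 = s.narr 1 := hf.narr 1 (by decide)
    have e8 : s'.narr 8 = s.narr 8 := hf.narr 8 (by decide)
    have e17 : s'.nreg 17 = s.nreg 17 := hf.nreg 17 (by decide)
    have ek := hI' k le_rfl
    have hh := hhalf k hk
    refine runs_of_loopFree rfl fun t ht => ⟨ht.trans (by decide), ?_⟩
    have hodd : (isOdd (.reg 8)).eval s' ↔ s.narr 0 k % 2 = 1 := by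
      have := isOdd_eval (s := s') (e := .reg 8) (by
        simp only [NExp.eval, e1, hv, ek]; exact hh)
      simpa [NExp.eval, ek, hv] using this
    have hnew : (halveStep.run s').narr 0 = Function.update (s'.narr 0) k
        (if s.narr 0 k % 2 = 1 ∧ s.narr 8 (k + 1) = s.nreg 17 then s.narr 0 k / 2 + 1
          else s.narr 0 k / 2) := by
      have heq : (s.narr 8 (k + 1) ≤ s.nreg 17 ∧ s.nreg 17 ≤ s.narr 8 (k + 1)) ↔
        s.narr 8 (k + 1) = s.nreg 17 := by omega
      by_cases c : s.narr 0 k % 2 = 1 ∧ s.narr 8 (k + 1) = s.nreg 17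
      · rw [if_pos c]
        simp [halveStep, Prog.run, Test.eval, NExp.eval, hodd, e1, e8, e17, hv, ek, hh, c.1, c.2]
      · rw [if_neg c]
        simp [halveStep, Prog.run, Test.eval, NExp.eval, hodd, e1, e8, e17, hv, ek, hh, heq, c]
    refine ⟨fun v hv' => ?_, fun v hv' => ?_⟩
    · simp only [State.setN, hnew, Function.update_apply]
      by_cases c : v = k
      · subst c
        rw [if_pos rfl]
        by_cases c1 : s.narr 0 v % 2 = 1
        · by_cases c2 : s.narr 8 (v + 1) = s.nreg 17
          · simp [sgn, c1, c2]; omega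
          · simp [sgn, c1, c2]; omega
        · simp [sgn, c1]; omega
      · rw [if_neg c]; exact hI v (by omega)
    · simp only [State.setN, hnew, Function.update_apply]
      rw [if_neg (by omega)]; exact hI' v (by omega)
  · rintro t s' - ⟨ht, hI, -⟩
    exact ⟨ht, hI⟩

end Rounding

/-! ### One round, and the accumulation of errors over all rounds -/

namespace Rounding

open RealRAM

/-- A list of the vertices `1, …, N` that is divided into lines of length `b`. -/
structure LineOrder (N b : ℕ) (σ E : ℕ → ℕ) : Prop where
  pos : 0 < b
  dvd : b ∣ N
  ne_zero : ∀ q < N, σ q ≠ 0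
  le : ∀ q < N, σ q ≤ N
  inj : ∀ q < N, ∀ q' < N, σ q = σ q' → q = q'
  ends : ∀ q < N, 1 ≤ E (q + 1) ↔ (q + 1) % b = 0

/-- The part of the state that a round of the algorithm reads but does not change. -/
structure Static (N P : ℕ) (σ E σ' E' : ℕ → ℕ) (s : State) : Prop where
  reg2 : s.nreg 2 = N
  reg5 : s.nreg 5 = N + N
  reg7 : s.nreg 7 = N + (N + N)
  half : ∀ k < P, s.narr 1 k = k / 2
  arr2 : s.narr 2 = σ
  arr3 : s.narr 3 = E
  arr5 : s.narr 5 = σ'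
  arr6 : s.narr 6 = E'
  arr4 : ∀ x, N + (N + N) < x → s.narr 4 x = 0
  arr7 : ∀ x, N + (N + N) < x → s.narr 7 x = 0
  arr8 : ∀ x, N + (N + N) < x → s.narr 8 x ≤ 2

/-- `K'` is obtained from `K` by halving with rounding errors `δ` that are small on lines and do not
increase the weight of the dummies. -/
structure Halving (N b c : ℕ) (σ σ' : ℕ → ℕ) (K K' : ℕ → ℕ) (δ : ℕ → ℤ) : Prop where
  abs_le : ∀ x, |δ x| ≤ 1
  eq : ∀ v < N + (N + N), 2 * (K' v : ℤ) = K v + δ (v + 1)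
  rows : Balanced N b σ N δ
  cols : Balanced N c σ' (N + N) δ
  dummies : ∑ i ∈ Finset.range (N + N), δ (N + i + 1) ≤ 0

theorem round_spec {N P b c : ℕ} {σ E σ' E' : ℕ → ℕ} {s : State} (hs : Static N P σ E σ' E' s)
    (hr : LineOrder N b σ E) (hc : LineOrder N c σ' E')
    (hK : ∀ v < N + (N + N), s.narr 0 v < P) :
    Runs round s fun t s' => t ≤ 687 * N + 90 ∧ Static N P σ E σ' E' s' ∧
      ∃ δ, Halving N b c σ σ' (s.narr 0) (s'.narr 0) δ := by
  refine Runs.seq (clear_spec hs.reg7 hs.arr4 hs.arr7 hs.arr8) ?_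
  rintro t₁ u₁ f₁ ⟨ht₁, z4, z7, z80, z8, z8'⟩
  have a0 : u₁.narr 0 = s.narr 0 := f₁.narr 0 (by decide)
  have a1 : u₁.narr 1 = s.narr 1 := f₁.narr 1 (by decide)
  have a2 : u₁.narr 2 = σ := (f₁.narr 2 (by decide)).trans hs.arr2
  have a3 : u₁.narr 3 = E := (f₁.narr 3 (by decide)).trans hs.arr3
  have a5 : u₁.narr 5 = σ' := (f₁.narr 5 (by decide)).trans hs.arr5
  have a6 : u₁.narr 6 = E' := (f₁.narr 6 (by decide)).trans hs.arr6
  have r2 : u₁.nreg 2 = N := (f₁.nreg 2 (by decide)).trans hs.reg2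
  have r5 : u₁.nreg 5 = N + N := (f₁.nreg 5 (by decide)).trans hs.reg5
  have r7 : u₁.nreg 7 = N + (N + N) := (f₁.nreg 7 (by decide)).trans hs.reg7
  have hhalf : ∀ v < N + (N + N), s.narr 1 (s.narr 0 v) = s.narr 0 v / 2 :=
    fun v hv => hs.half _ (hK v hv)
  refine Runs.seq (sweep_spec (N := N) (inner := b) (d := N) (by decide) (by decide) (by decide)
    (by decide) (by decide) r2 r2 le_rfl hr.pos hr.dvd (by rw [a2]; exact hr.ne_zero)
    (by rw [a2]; exact hr.le) (by rw [a2]; exact hr.inj) (by rw [a3]; exact hr.ends)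
    (by rw [a0, a1]; exact fun v hv => hhalf v (by omega)) z4) ?_
  rintro t₂ u₂ f₂ ⟨ht₂, pA, bA⟩
  rw [a0] at pA bA
  rw [a2] at bA
  have b0 : u₂.narr 0 = s.narr 0 := (f₂.narr 0 (by decide)).trans a0
  have b1 : u₂.narr 1 = s.narr 1 := (f₂.narr 1 (by decide)).trans a1
  have b5 : u₂.narr 5 = σ' := (f₂.narr 5 (by decide)).trans a5
  have b6 : u₂.narr 6 = E' := (f₂.narr 6 (by decide)).trans a6
  have b7 : u₂.narr 7 = u₁.narr 7 := f₂.narr 7 (by decide)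
  have b8 : u₂.narr 8 = u₁.narr 8 := f₂.narr 8 (by decide)
  have r2' : u₂.nreg 2 = N := (f₂.nreg 2 (by decide)).trans r2
  have r5' : u₂.nreg 5 = N + N := (f₂.nreg 5 (by decide)).trans r5
  refine Runs.seq (sweep_spec (N := N) (inner := c) (d := N + N) (by decide) (by decide) (by decide)
    (by decide) (by decide) r2' r5' (by omega) hc.pos hc.dvd (by rw [b5]; exact hc.ne_zero)
    (by rw [b5]; exact hc.le) (by rw [b5]; exact hc.inj) (by rw [b6]; exact hc.ends)
    (by rw [b0, b1]; exact fun v hv => hhalf v (by omega)) (by rw [b7]; exact z7)) ?_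
  rintro t₃ u₃ f₃ ⟨ht₃, pB, bB⟩
  rw [b0] at pB bB
  rw [b5] at bB
  have c0 : u₃.narr 0 = s.narr 0 := (f₃.narr 0 (by decide)).trans b0
  have c1 : u₃.narr 1 = s.narr 1 := (f₃.narr 1 (by decide)).trans b1
  have c4 : u₃.narr 4 = u₂.narr 4 := f₃.narr 4 (by decide)
  have c8 : u₃.narr 8 = u₁.narr 8 := (f₃.narr 8 (by decide)).trans b8
  have r2'' : u₃.nreg 2 = N := (f₃.nreg 2 (by decide)).trans r2'
  have r5'' : u₃.nreg 5 = N + N := (f₃.nreg 5 (by decide)).trans r5'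
  have r7'' : u₃.nreg 7 = N + (N + N) :=
    (f₃.nreg 7 (by decide)).trans ((f₂.nreg 7 (by decide)).trans r7)
  -- The row matching involves only entries and row dummies, the vertices up to `2 * N`; it is
  -- regarded as a matching on all `3 * N` vertices.
  have pA' : Pairing (s.narr 0) (Set.Icc 1 (N + (N + N))) (u₃.narr 4) := by
    rw [c4]; exact pA.mono (Set.Icc_subset_Icc_right (by omega)) (by simp)
  rw [add_assoc] at pB
  refine Runs.seq (color_spec pA' pB r7'' (by rw [c8]; exact z80) (by rw [c8]; exact z8)
    (by rw [c8]; exact z8')) ?_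
  rintro t₄ u₄ f₄ ⟨ht₄, hC, hne⟩
  have d0 : u₄.narr 0 = s.narr 0 := (f₄.narr 0 (by decide)).trans c0
  have d1 : u₄.narr 1 = s.narr 1 := (f₄.narr 1 (by decide)).trans c1
  have hcol : ∀ x, 1 ≤ x → x ≤ N + (N + N) → u₄.narr 8 x = 1 ∨ u₄.narr 8 x = 2 := by
    intro x h1 h2
    have h3 := hne x h1 h2
    have h4 := hC.le_two x (by omega)
    omega
  refine Runs.seq (vote_spec (N := N) (D := N + N) ((f₄.nreg 2 (by decide)).trans r2'')
    ((f₄.nreg 5 (by decide)).trans r5'') (by rw [d0, d1]; exact hhalf) hcol) ?_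
  rintro t₅ u₅ f₅ ⟨ht₅, h17, hsum⟩
  have e0 : u₅.narr 0 = s.narr 0 := (f₅.narr 0 (by decide)).trans d0
  have e1 : u₅.narr 1 = s.narr 1 := (f₅.narr 1 (by decide)).trans d1
  have e8 : u₅.narr 8 = u₄.narr 8 := f₅.narr 8 (by decide)
  refine (halve_spec (L := N + (N + N))
    ((f₅.nreg 7 (by decide)).trans ((f₄.nreg 7 (by decide)).trans r7''))
    (by rw [e0, e1]; exact hhalf)).mono ?_
  rintro t₆ u₆ f₆ ⟨ht₆, hhalve⟩
  rw [e0, e8] at hhalve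
  rw [d0] at hsum
  have sA : Signing (s.narr 0) (u₃.narr 4) (sgn (s.narr 0) (u₄.narr 8) (u₅.nreg 17)) :=
    signing_sgn pA' hC.properA hcol h17
  have sB : Signing (s.narr 0) (u₃.narr 7) (sgn (s.narr 0) (u₄.narr 8) (u₅.nreg 17)) :=
    signing_sgn pB hC.properB hcol h17
  have hreg : ∀ v, v < 8 → u₆.nreg v = u₃.nreg v := by
    intro v hv
    have hv' : v ≠ 8 ∧ v ≠ 13 ∧ v ≠ 14 ∧ v ≠ 15 ∧ v ≠ 16 ∧ v ≠ 17 := by omega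
    rw [f₆.nreg v, f₅.nreg v, f₄.nreg v]
    all_goals
      simp [halve, halveStep, vote, voteStep, color, walk, walkStep, forLoop, Prog.nregs, hv']
  have harr : ∀ a, a ≠ 0 → a ≠ 8 → u₆.narr a = u₃.narr a := by
    intro a h0 h8
    rw [f₆.narr a, f₅.narr a, f₄.narr a]
    all_goals
      simp [halve, halveStep, vote, voteStep, color, walk, walkStep, forLoop, Prog.narrs, h0, h8]
  -- The coefficient is `687 = 3 * 24 + 2 * 120 + 3 * 45 + 2 * 45 + 3 * 50`, for clearing, two
  -- sweeps, colouring, vote and halving.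
  refine ⟨by omega, ?_, _, ⟨sA.abs_le, hhalve, bA _ (by rw [← c4]; exact sA), bB _ sB, hsum⟩⟩
  refine ⟨(hreg 2 (by decide)).trans r2'', (hreg 5 (by decide)).trans r5'',
    (hreg 7 (by decide)).trans r7'', ?_, ?_, ?_, ?_, ?_, ?_, ?_, ?_⟩
  · rw [harr 1 (by decide) (by decide), c1]; exact hs.half
  · rw [harr 2 (by decide) (by decide), f₃.narr 2 (by decide), f₂.narr 2 (by decide), a2]
  · rw [harr 3 (by decide) (by decide), f₃.narr 3 (by decide), f₂.narr 3 (by decide), a3]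
  · rw [harr 5 (by decide) (by decide), f₃.narr 5 (by decide), b5]
  · rw [harr 6 (by decide) (by decide), f₃.narr 6 (by decide), b6]
  · intro x hx
    rw [harr 4 (by decide) (by decide)]
    by_contra hh
    have := (pA'.supp x hh).2
    omega
  · intro x hx
    rw [harr 7 (by decide) (by decide)]
    by_contra hh
    have := (pB.supp x hh).2
    omega
  · intro x hx
    rw [f₆.narr 8 (by decide), e8]
    exact hC.le_two x (by omega)

/-- The weight `K (x - 1)` of the vertex `x`. -/
def weight (K : ℕ → ℕ) (x : ℕ) : ℤ := K (x - 1)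

/-- After `r` halvings, the sums over initial segments of lines are still close to the original
ones. -/
def Close (N b : ℕ) (σ : ℕ → ℕ) (d r : ℕ) (K₀ K : ℕ → ℕ) : Prop :=
  (∀ q < N, |2 ^ r * seg σ d (weight K) (q / b * b) (q + 1) -
    seg σ d (weight K₀) (q / b * b) (q + 1)| ≤ 2 ^ r - 1) ∧
  |2 ^ r * seg σ d (weight K) 0 N - seg σ d (weight K₀) 0 N| ≤ 2 ^ r - 1

theorem close_zero (N b : ℕ) (σ : ℕ → ℕ) (d : ℕ) (K : ℕ → ℕ) : Close N b σ d 0 K K := by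
  constructor <;> simp

/-- A rounding unit in round `r` counts `2 ^ r` in the original scale, and `(2 ^ r - 1) + 2 ^ r = 2
^ (r + 1) - 1`. -/
theorem abs_halving {r : ℕ} {x y z w : ℤ} (h : |2 ^ r * x - w| ≤ 2 ^ r - 1) (hz : |z| ≤ 1)
    (hy : 2 * y = x + z) : |2 ^ (r + 1) * y - w| ≤ 2 ^ (r + 1) - 1 := by
  have e : (2 : ℤ) ^ (r + 1) * y - w = (2 ^ r * x - w) + 2 ^ r * z := by
    rw [pow_succ, mul_assoc, hy]; ring
  have hp : (0 : ℤ) < 2 ^ r := by positivity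
  have h2 : |(2 : ℤ) ^ r * z| ≤ 2 ^ r := by
    rw [abs_mul, abs_of_pos hp]; nlinarith
  rw [e]
  refine (abs_add_le _ _).trans ?_
  rw [pow_succ]; linarith

theorem Close.step {N b d r : ℕ} {σ E : ℕ → ℕ} {K₀ K K' : ℕ → ℕ} {δ : ℕ → ℤ}
    (h : Close N b σ d r K₀ K) (hσ : LineOrder N b σ E)
    (heq : ∀ v < d + N, 2 * (K' v : ℤ) = K v + δ (v + 1)) (hδ : Balanced N b σ d δ) :
    Close N b σ d (r + 1) K₀ K' := by
  have key : ∀ a c, c ≤ N → 2 * seg σ d (weight K') a c =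
      seg σ d (weight K) a c + seg σ d δ a c := by
    intro a c hc
    rw [seg, seg, seg, Finset.mul_sum, ← Finset.sum_add_distrib]
    refine Finset.sum_congr rfl fun q hq => ?_
    have hq' := (Finset.mem_Ico.1 hq).2
    have h1 := hσ.ne_zero q (by omega)
    have h2 := hσ.le q (by omega)
    have e1 := heq (σ q - 1) (by omega)
    have e2 := heq (d + q) (by omega)
    rw [Nat.sub_add_cancel (by omega)] at e1
    simp only [weight, Nat.add_sub_cancel]
    linarith
  exact ⟨fun q hq => abs_halving (h.1 q hq) (hδ.1 q hq) (key _ _ hq),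
    abs_halving h.2 hδ.2 (key _ _ le_rfl)⟩

/-- The relation between the weights at the beginning and after `r` rounds. -/
structure Progress (N b c : ℕ) (σ σ' : ℕ → ℕ) (r : ℕ) (K₀ K : ℕ → ℕ) : Prop where
  le : ∀ v < N + (N + N), K v ≤ K₀ v
  lt : ∀ v < N + (N + N), 2 ^ r * (K v : ℤ) ≤ K₀ v + (2 ^ r - 1)
  rows : Close N b σ N r K₀ K
  cols : Close N c σ' (N + N) r K₀ K
  dummies : 2 ^ r * ∑ i ∈ Finset.range (N + N), (K (N + i) : ℤ) ≤
    ∑ i ∈ Finset.range (N + N), (K₀ (N + i) : ℤ)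

theorem Progress.refl (N b c : ℕ) (σ σ' K : ℕ → ℕ) : Progress N b c σ σ' 0 K K :=
  ⟨fun _ _ => le_rfl, fun _ _ => by simp, close_zero _ _ _ _ _, close_zero _ _ _ _ _, by simp⟩

theorem Progress.step {N b c r : ℕ} {σ E σ' E' : ℕ → ℕ} {K₀ K K' : ℕ → ℕ} {δ : ℕ → ℤ}
    (h : Progress N b c σ σ' r K₀ K) (hr : LineOrder N b σ E) (hc : LineOrder N c σ' E')
    (hδ : Halving N b c σ σ' K K' δ) : Progress N b c σ σ' (r + 1) K₀ K' := by
  have hp : (0 : ℤ) < 2 ^ r := by positivity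
  refine ⟨fun v hv => ?_, fun v hv => ?_,
    h.rows.step hr (fun v hv => hδ.eq v (by omega)) hδ.rows,
    h.cols.step hc (fun v hv => hδ.eq v (by omega)) hδ.cols, ?_⟩
  -- A weight 0 stays 0 by integrality, and `(k + 1) / 2 ≤ k` for `k ≥ 1`. Weights therefore never
  -- increase, which also keeps them in the range of the halving table.
  · have h1 := hδ.eq v hv
    have h2 := abs_le.1 (hδ.abs_le (v + 1))
    have h3 := h.le v hv
    omega
  · have h1 := hδ.eq v hv
    have h2 := abs_le.1 (hδ.abs_le (v + 1))
    have h3 := h.lt v hv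
    have e : (2 : ℤ) ^ (r + 1) * (K' v : ℤ) = 2 ^ r * K v + 2 ^ r * δ (v + 1) := by
      rw [pow_succ, mul_assoc, h1]; ring
    rw [e, pow_succ]
    nlinarith
  · have e : 2 * ∑ i ∈ Finset.range (N + N), (K' (N + i) : ℤ) =
        ∑ i ∈ Finset.range (N + N), (K (N + i) : ℤ) +
          ∑ i ∈ Finset.range (N + N), δ (N + i + 1) := by
      rw [Finset.mul_sum, ← Finset.sum_add_distrib]
      exact Finset.sum_congr rfl fun i hi => hδ.eq _ (by
        have := Finset.mem_range.1 hi; omega)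
    have h1 := h.dummies
    have h2 := hδ.dummies
    rw [pow_succ, mul_assoc, e]
    nlinarith

theorem rounds_spec {N P b c T : ℕ} {σ E σ' E' : ℕ → ℕ} {s : State}
    (hs : Static N P σ E σ' E' s) (h4 : s.nreg 4 = T)
    (hr : LineOrder N b σ E) (hc : LineOrder N c σ' E')
    (hK : ∀ v < N + (N + N), s.narr 0 v < P) :
    Runs (forLoop 21 4 round) s fun t s' => t ≤ (687 * N + 99) * T + 7 ∧
      Progress N b c σ σ' T (s.narr 0) (s'.narr 0) := by
  refine (runs_forLoop (fun r s' => Static N P σ E σ' E' s' ∧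
    Progress N b c σ σ' r (s.narr 0) (s'.narr 0)) (687 * N + 90) h4 (by decide) (by decide)
    (by decide) ⟨?_, Progress.refl _ _ _ _ _ _⟩ ?_).mono ?_
  · exact ⟨hs.reg2, hs.reg5, hs.reg7, hs.half, hs.arr2, hs.arr3, hs.arr5, hs.arr6, hs.arr4, hs.arr7,
      hs.arr8⟩
  · rintro r s' - - - ⟨h1, h2⟩
    refine (round_spec h1 hr hc fun v hv => (h2.le v hv).trans_lt (hK v hv)).mono ?_
    rintro t u - ⟨ht, hu, δ, hδ⟩
    exact ⟨ht, ⟨hu.reg2, hu.reg5, hu.reg7, hu.half, hu.arr2, hu.arr3, hu.arr5, hu.arr6, hu.arr4,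
      hu.arr7, hu.arr8⟩, h2.step hr hc hδ⟩
  · rintro t s' - ⟨ht, -, h⟩
    exact ⟨ht, h⟩

end Rounding

/-! ### The row and column orders, and the preparation as a whole -/

namespace Rounding

open RealRAM

theorem Layout.lineOrder_rows {m n d : ℕ} {f : ℕ → ℝ} {σ E K : ℕ → ℕ} (hn : 0 < n)
    (h : Layout (m * n) n 1 n d f σ E K) : LineOrder (m * n) n σ E := by
  have e : ∀ q < m * n, σ q = q + 1 := fun q hq => by
    rw [h.entry q hq, mul_one, Nat.div_add_mod']
  refine ⟨hn, Dvd.intro_left m rfl, fun q hq => ?_, fun q hq => ?_, fun q hq q' hq' => ?_, h.ends⟩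
  · rw [e q hq]; omega
  · rw [e q hq]; omega
  · rw [e q hq, e q' hq']; omega

theorem transpose_lt {m n q : ℕ} (hq : q < m * n) : q / m * 1 + q % m * n < m * n := by
  have hm : 0 < m := Nat.pos_of_ne_zero (by rintro rfl; simp at hq)
  have h1 : q / m < n := Nat.div_lt_of_lt_mul hq
  have h2 : q % m + 1 ≤ m := Nat.mod_lt q hm
  calc q / m * 1 + q % m * n < (q % m + 1) * n := by rw [add_mul]; omega
    _ ≤ m * n := Nat.mul_le_mul_right _ h2

/-- Position `q` of the column order is the entry with address `q / m + n * (q % m)`. Since `q / m <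
n`, quotient and remainder of the address by `n` recover `q`, which gives injectivity. -/
theorem Layout.lineOrder_cols {m n d : ℕ} {f : ℕ → ℝ} {σ E K : ℕ → ℕ} (hm : 0 < m)
    (h : Layout (m * n) m n 1 d f σ E K) : LineOrder (m * n) m σ E := by
  refine ⟨hm, Dvd.intro n rfl, fun q hq => ?_, fun q hq => ?_, fun q hq q' hq' hh => ?_, h.ends⟩
  · rw [h.entry q hq]; omega
  · rw [h.entry q hq]; exact transpose_lt hq
  · rw [h.entry q hq, h.entry q' hq'] at hh
    have h1 : q / m < n := Nat.div_lt_of_lt_mul hq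
    have h1' : q' / m < n := Nat.div_lt_of_lt_mul hq'
    have hn : 0 < n := by omega
    have h2 : q / m + n * (q % m) = q' / m + n * (q' % m) := by
      rw [mul_comm n, mul_comm n]; omega
    have h3 : q / m = q' / m := by
      have := congrArg (· % n) h2
      simpa [Nat.add_mul_mod_self_left, Nat.mod_eq_of_lt h1, Nat.mod_eq_of_lt h1'] using this
    have h4 : q % m = q' % m := by
      have h5 : n * (q % m) = n * (q' % m) := by omega
      exact Nat.eq_of_mul_eq_mul_left hn h5
    rw [← Nat.div_add_mod q m, ← Nat.div_add_mod q' m, h3, h4]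

theorem prepare_spec {m n : ℕ} (hm : 0 < m) (hn : 0 < n) {s : State} (h0 : s.nreg 0 = m)
    (h1 : s.nreg 1 = n) (h2 : s.nreg 2 = 0) (h4 : s.nreg 4 = 0) (hz : ∀ a k, s.narr a k = 0)
    (hx : ∀ e < m * n, 0 ≤ s.rarr 0 e ∧ s.rarr 0 e < 1) :
    Runs prepare s fun t s' => t ≤ 400 * (m * n * s'.nreg 4) ∧
      s'.nreg 4 = Nat.log 2 (m * n + m * n) + 1 ∧
      Static (m * n) (2 ^ s'.nreg 4) (s'.narr 2) (s'.narr 3) (s'.narr 5) (s'.narr 6) s' ∧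
      ∃ f : ℕ → ℝ, (∀ e < m * n, (s'.narr 0 e : ℝ) + f e = 2 ^ s'.nreg 4 * s.rarr 0 e ∧
        0 ≤ f e ∧ f e < 1) ∧
      Layout (m * n) n 1 n (m * n) f (s'.narr 2) (s'.narr 3) (s'.narr 0) ∧
      Layout (m * n) m n 1 (m * n + m * n) f (s'.narr 5) (s'.narr 6) (s'.narr 0) := by
  set N := m * n with hN
  have hNpos : 0 < N := Nat.mul_pos hm hn
  refine Runs.seq (countEntries_spec h0 h1 h2) ?_
  rintro t₁ u₁ f₁ ⟨ht₁, r2⟩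
  rw [← hN] at r2
  refine Runs.seq_of_loopFree rfl fun t₂ ht₂ => ?_
  set u₂ := setConstants.run u₁ with hu₂
  have g₂ : Frame setConstants u₁ u₂ := run_frame rfl u₁
  have a2 : u₂.nreg 2 = N := r2
  have a5 : u₂.nreg 5 = N + N := by simp [hu₂, setConstants, Prog.run, NExp.eval, r2]
  have a6 : u₂.nreg 6 = 1 := rfl
  have a7 : u₂.nreg 7 = N + (N + N) := by simp [hu₂, setConstants, Prog.run, NExp.eval, r2]
  have a3 : u₂.nreg 3 = 1 := rfl
  have a4 : u₂.nreg 4 = 0 := by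
    rw [g₂.nreg 4 (by decide), f₁.nreg 4 (by decide), h4]
  have a0 : u₂.nreg 0 = m := by
    rw [g₂.nreg 0 (by decide), f₁.nreg 0 (by decide), h0]
  have a1 : u₂.nreg 1 = n := by
    rw [g₂.nreg 1 (by decide), f₁.nreg 1 (by decide), h1]
  have az : ∀ a, u₂.narr a = s.narr a := fun a => f₁.narr a (by
    simp [countEntries, forLoop, Prog.narrs])
  have ar : u₂.rarr 0 = s.rarr 0 := f₁.rarr 0 (by decide)
  refine Runs.seq (findPower_spec (D := N + N) (by omega) a3 a4 a5) ?_
  rintro t₃ u₃ f₃ ⟨ht₃, p3, p4⟩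
  set T := u₃.nreg 4 with hT
  refine Runs.seq (halfTable_spec p3 (fun k => ?_)) ?_
  · rw [f₃.narr 1 (by decide), az, hz]
  rintro t₄ u₄ f₄ ⟨ht₄, hhalf⟩
  have b4 : u₄.nreg 4 = T := f₄.nreg 4 (by decide)
  have b2 : u₄.nreg 2 = N := by rw [f₄.nreg 2 (by decide), f₃.nreg 2 (by decide), a2]
  have br : u₄.rarr 0 = s.rarr 0 := by rw [f₄.rarr 0 (by decide), f₃.rarr 0 (by decide), ar]
  refine Runs.seq (digits_spec b2 b4 (by rw [br]; exact hx)) ?_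
  rintro t₅ u₅ f₅ ⟨ht₅, hdig⟩
  have creg : ∀ v < 8, v ≠ 3 → v ≠ 4 → u₅.nreg v = u₂.nreg v := by
    intro v hv h3 h4
    have hv' : v ≠ 8 ∧ v ≠ 9 ∧ v ≠ 10 := by omega
    rw [f₅.nreg v, f₄.nreg v, f₃.nreg v]
    all_goals simp [findPower, halfTable, digits, digitStep, forLoop, Prog.nregs, hv', h3, h4]
  have c4 : u₅.nreg 4 = T := (f₅.nreg 4 (by decide)).trans b4
  have carr : ∀ a, a ≠ 0 → a ≠ 1 → ∀ k, u₅.narr a k = 0 := by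
    intro a h0 h1 k
    rw [f₅.narr a, f₄.narr a, f₃.narr a, az, hz]
    all_goals simp [findPower, halfTable, digits, digitStep, forLoop, Prog.narrs, h0, h1]
  have c0 : u₅.nreg 0 = m := (creg 0 (by decide) (by decide) (by decide)).trans a0
  have c1 : u₅.nreg 1 = n := (creg 1 (by decide) (by decide) (by decide)).trans a1
  have c2 : u₅.nreg 2 = N := (creg 2 (by decide) (by decide) (by decide)).trans a2
  have c5 : u₅.nreg 5 = N + N := (creg 5 (by decide) (by decide) (by decide)).trans a5
  have c6 : u₅.nreg 6 = 1 := (creg 6 (by decide) (by decide) (by decide)).trans a6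
  have c7 : u₅.nreg 7 = N + (N + N) := (creg 7 (by decide) (by decide) (by decide)).trans a7
  have lay₁ := layout_spec (σ := 2) (E := 3) (inner := 1) (is := 6) (os := 1) (db := 2) (N := N)
    (s := u₅) (by decide) (by decide) (by decide) (by decide) (by decide) (by decide) (by decide)
    (by rw [c1]; exact hn) c2 (carr 3 (by decide) (by decide)) (by
      intro q hq
      rw [c1, c6, mul_one, Nat.div_add_mod']
      exact (hdig q hq).2)
  refine Runs.seq lay₁ ?_
  rintro t₆ u₆ f₆ ⟨ht₆, hL₁, hsame₁⟩
  rw [c1, c2, c6] at hL₁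
  rw [c2] at hsame₁
  have dreg : ∀ v < 8, u₆.nreg v = u₅.nreg v := by
    intro v hv
    have hv' : v ≠ 8 ∧ v ≠ 18 ∧ v ≠ 19 ∧ v ≠ 20 := by omega
    refine f₆.nreg v ?_
    simp [layout, layoutStep, forLoop, Prog.nregs, hv']
  have dr : u₆.rarr 0 = u₅.rarr 0 := f₆.rarr 0 (by decide)
  have d0 : u₆.nreg 0 = m := (dreg 0 (by decide)).trans c0
  have d1 : u₆.nreg 1 = n := (dreg 1 (by decide)).trans c1
  have d2 : u₆.nreg 2 = N := (dreg 2 (by decide)).trans c2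
  have d5 : u₆.nreg 5 = N + N := (dreg 5 (by decide)).trans c5
  have d6 : u₆.nreg 6 = 1 := (dreg 6 (by decide)).trans c6
  have lay₂ := layout_spec (σ := 5) (E := 6) (inner := 0) (is := 1) (os := 6) (db := 5) (N := N)
    (s := u₆) (by decide) (by decide) (by decide) (by decide) (by decide) (by decide) (by decide)
    (by rw [d0]; exact hm) d2
    (by rw [f₆.narr 6 (by decide)]; exact carr 6 (by decide) (by decide)) (by
      intro q hq
      rw [d0, d1, d6, dr]
      exact (hdig _ (transpose_lt hq)).2)
  refine lay₂.mono ?_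
  rintro t₇ u₇ f₇ ⟨ht₇, hL₂, hsame₂⟩
  rw [d0, d1, d5, d6, dr] at hL₂
  rw [d5] at hsame₂
  have ereg : ∀ v < 8, u₇.nreg v = u₅.nreg v := by
    intro v hv
    have hv' : v ≠ 8 ∧ v ≠ 18 ∧ v ≠ 19 ∧ v ≠ 20 := by omega
    rw [← dreg v hv]
    refine f₇.nreg v ?_
    simp [layout, layoutStep, forLoop, Prog.nregs, hv']
  have e4 : u₇.nreg 4 = T := (ereg 4 (by decide)).trans c4
  have e2 : u₇.narr 2 = u₆.narr 2 := f₇.narr 2 (by decide)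
  have e3 : u₇.narr 3 = u₆.narr 3 := f₇.narr 3 (by decide)
  have earr : ∀ a, a ≠ 0 → a ≠ 2 → a ≠ 3 → a ≠ 5 → a ≠ 6 → u₇.narr a = u₅.narr a := by
    intro a k0 k2 k3 k5 k6
    rw [f₇.narr a, f₆.narr a]
    all_goals simp [layout, layoutStep, forLoop, Prog.narrs, k0, k2, k3, k5, k6]
  have e1 : u₇.narr 1 = u₄.narr 1 := by
    rw [earr 1 (by decide) (by decide) (by decide) (by decide) (by decide), f₅.narr 1 (by decide)]
  rw [e4]
  refine ⟨?_, p4, ⟨(ereg 2 (by decide)).trans c2, (ereg 5 (by decide)).trans c5,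
    (ereg 7 (by decide)).trans c7, fun k hk => by rw [e1]; exact hhalf k (by omega), rfl, rfl, rfl,
    rfl, ?_, ?_, ?_⟩, u₅.rarr 0, ?_, ?_, hL₂⟩
  -- Minimality of the power keeps the halving table of linear size.
  · have hP : 2 ^ T ≤ 4 * N := by
      rw [p4, pow_succ]
      have := Nat.pow_log_le_self 2 (x := N + N) (by omega)
      omega
    have hmN : m ≤ N := Nat.le_mul_of_pos_right m hn
    have hT1 : 1 ≤ T := by omega
    have hNT : N ≤ N * T := Nat.le_mul_of_pos_right N hT1
    have hTN : T ≤ N * T := Nat.le_mul_of_pos_left T hNpos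
    have e5 : (38 * T + 29) * N = 38 * (N * T) + 29 * N := by ring
    rw [e5] at ht₅
    have hw : t₂ ≤ 12 := ht₂
    omega
  · intro x _
    rw [earr 4 (by decide) (by decide) (by decide) (by decide) (by decide)]
    exact carr 4 (by decide) (by decide) x
  · intro x _
    rw [earr 7 (by decide) (by decide) (by decide) (by decide) (by decide)]
    exact carr 7 (by decide) (by decide) x
  · intro x _
    rw [earr 8 (by decide) (by decide) (by decide) (by decide) (by decide),
      carr 8 (by decide) (by decide) x]
    omega
  · intro e he
    rw [hsame₂ e (by omega), hsame₁ e (by omega), ← br]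
    exact hdig e he
  · rw [e2, e3]
    refine ⟨hL₁.entry, hL₁.ends, ?_, fun q hq => ?_⟩
    · obtain ⟨acc, h1, h2⟩ := hL₁.carry
      refine ⟨acc, h1, fun q hq => ?_⟩
      rw [h2 q hq, hsame₂ (N + q) (by omega)]
    · rw [hsame₂ (N + q) (by omega)]; exact hL₁.le_one q hq

/-! ### From the final weights back to the matrix -/

/-- The carry recursion telescopes: the difference is `acc a - acc c`, with both terms in `[0, 1)`.
-/
theorem Layout.sum_entries {N b is os d : ℕ} {f x : ℕ → ℝ} {T : ℕ} {σ E K : ℕ → ℕ}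
    (h : Layout N b is os d f σ E K) (hσ : LineOrder N b σ E)
    (hx : ∀ e < N, (K e : ℝ) + f e = 2 ^ T * x e) {a c : ℕ} (hac : a ≤ c) (hc : c ≤ N) :
    |(seg σ d (weight K) a c : ℝ) -
      2 ^ T * ∑ q ∈ Finset.Ico a c, x (q / b * os + q % b * is)| < 1 := by
  obtain ⟨acc, hacc, hrec⟩ := h.carry
  have key : (seg σ d (weight K) a c : ℝ) -
      2 ^ T * ∑ q ∈ Finset.Ico a c, x (q / b * os + q % b * is) = acc a - acc c := by
    rw [← neg_sub (acc c), ← Finset.sum_Ico_sub acc hac, seg, Int.cast_sum, Finset.mul_sum,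
      ← Finset.sum_sub_distrib, ← Finset.sum_neg_distrib]
    refine Finset.sum_congr rfl fun q hq => ?_
    have hq' : q < N := by have := (Finset.mem_Ico.1 hq).2; omega
    have h1 := hrec q hq'
    have h2 := h.entry q hq'
    have h3 := hσ.le q hq'
    have h4 := hx (q / b * os + q % b * is) (by omega)
    simp only [weight, h2, Nat.add_sub_cancel]
    push_cast
    linarith
  rw [key, abs_lt]
  have h1 := hacc a (by omega)
  have h2 := hacc c hc
  constructor <;> linarith

/-- With vanishing dummies the final segment sum involves entries only. The halving error, at most
`2 ^ T - 1`, and the error of the carries, strictly below 1, together stay below `2 ^ T`. -/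
theorem abs_sum_lt_one {N b is os d : ℕ} {f x : ℕ → ℝ} {T : ℕ} {σ E K₀ K : ℕ → ℕ}
    (h : Layout N b is os d f σ E K₀) (hσ : LineOrder N b σ E)
    (hx : ∀ e < N, (K₀ e : ℝ) + f e = 2 ^ T * x e) (hd : ∀ q < N, K (d + q) = 0) {a c : ℕ}
    (hac : a ≤ c) (hc : c ≤ N)
    (hclose : |2 ^ T * seg σ d (weight K) a c - seg σ d (weight K₀) a c| ≤ 2 ^ T - 1) :
    |∑ q ∈ Finset.Ico a c, (x (q / b * os + q % b * is) - K (q / b * os + q % b * is))| < 1 := by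
  have h1 := h.sum_entries hσ hx hac hc
  have h2 : (seg σ d (weight K) a c : ℝ) =
      ∑ q ∈ Finset.Ico a c, (K (q / b * os + q % b * is) : ℝ) := by
    rw [seg, Int.cast_sum]
    refine Finset.sum_congr rfl fun q hq => ?_
    have hq' : q < N := by have := (Finset.mem_Ico.1 hq).2; omega
    simp [weight, h.entry q hq', hd q hq']
  have h3 : |(2 : ℝ) ^ T * seg σ d (weight K) a c - seg σ d (weight K₀) a c| ≤ 2 ^ T - 1 := by
    exact_mod_cast hclose
  have hp : (0 : ℝ) < 2 ^ T := by positivity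
  rw [Finset.sum_sub_distrib, ← h2]
  rw [abs_lt] at h1 ⊢
  rw [abs_le] at h3
  constructor <;> nlinarith

theorem sum_Iic_fin {n : ℕ} (b : Fin n) (g : ℕ → ℝ) :
    ∑ j ∈ Finset.Iic b, g j = ∑ j ∈ Finset.range (b + 1), g j := by
  have := Finset.sum_map (Finset.Iic b) Fin.valEmbedding g
  rw [Fin.map_valEmbedding_Iic] at this
  rw [Nat.range_succ_eq_Iic, this]
  rfl

theorem sum_range_mul {m n : ℕ} (g : ℕ → ℝ) :
    ∑ q ∈ Finset.range (m * n), g q = ∑ i : Fin m, ∑ j : Fin n, g (i * n + j) := by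
  rw [Finset.sum_range, ← Fintype.sum_prod_type' (f := fun (i : Fin m) (j : Fin n) => g (i * n + j)),
    ← finProdFinEquiv.sum_comp]
  refine Finset.sum_congr rfl fun p _ => ?_
  congr 1
  simp [finProdFinEquiv]; ring

theorem mul_add_div_mod {n i j : ℕ} (hj : j < n) : (i * n + j) / n = i ∧ (i * n + j) % n = j := by
  constructor
  · rw [add_comm, Nat.add_mul_div_right _ _ (by omega), Nat.div_eq_of_lt hj, zero_add]
  · rw [add_comm, Nat.add_mul_mod_self_right, Nat.mod_eq_of_lt hj]

theorem mul_add_lt {m n i j : ℕ} (hi : i < m) (hj : j < n) : i * n + j < m * n := by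
  calc i * n + j < (i + 1) * n := by rw [add_mul]; omega
    _ ≤ m * n := Nat.mul_le_mul_right _ hi

theorem isGoodRounding_of_progress {m n T : ℕ} (X : Matrix (Fin m) (Fin n) ℝ)
    (hX : ∀ i j, X i j ∈ Set.Ico (0 : ℝ) 1) {x f : ℕ → ℝ}
    (hxX : ∀ (i : Fin m) (j : Fin n), x (i * n + j) = X i j) {σ E σ' E' K₀ K : ℕ → ℕ}
    (hT : m * n + m * n < 2 ^ T)
    (hx : ∀ e < m * n, (K₀ e : ℝ) + f e = 2 ^ T * x e) (hf : ∀ e < m * n, 0 ≤ f e ∧ f e < 1)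
    (hr : LineOrder (m * n) n σ E) (hc : LineOrder (m * n) m σ' E')
    (hL : Layout (m * n) n 1 n (m * n) f σ E K₀)
    (hL' : Layout (m * n) m n 1 (m * n + m * n) f σ' E' K₀)
    (hp : Progress (m * n) n m σ σ' T K₀ K) :
    IsGoodRounding X (fun i j => K (i * n + j)) := by
  have h2 : (0 : ℝ) < 2 ^ T := by positivity
  have hTz : ((m * n + m * n : ℕ) : ℤ) < 2 ^ T := by exact_mod_cast hT
  -- The initial total of the dummies is at most `2 * N < 2 ^ T`, and `2 ^ T` times the final total
  -- does not exceed it.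
  have hdum : ∀ i < m * n + m * n, K (m * n + i) = 0 := by
    have h1 : ∑ i ∈ Finset.range (m * n + m * n), (K₀ (m * n + i) : ℤ) ≤
        ((m * n + m * n : ℕ) : ℤ) := by
      refine (Finset.sum_le_card_nsmul _ _ 1 fun i hi => ?_).trans (by simp)
      have hi' := Finset.mem_range.1 hi
      by_cases c : i < m * n
      · exact_mod_cast hL.le_one i c
      · have := hL'.le_one (i - m * n) (by omega)
        rw [show m * n + m * n + (i - m * n) = m * n + i by omega] at this
        exact_mod_cast this
    have h3 := hp.dummies
    have hnn : ∀ i ∈ Finset.range (m * n + m * n), 0 ≤ (K (m * n + i) : ℤ) := fun i _ => by positivity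
    have h4 : ∑ i ∈ Finset.range (m * n + m * n), (K (m * n + i) : ℤ) = 0 := by
      have h5 := Finset.sum_nonneg hnn
      by_contra h6
      have h7 : 1 ≤ ∑ i ∈ Finset.range (m * n + m * n), (K (m * n + i) : ℤ) := by omega
      nlinarith
    intro i hi
    exact_mod_cast (Finset.sum_eq_zero_iff_of_nonneg hnn).1 h4 i (Finset.mem_range.2 hi)
  have hval : ∀ (i : Fin m) (j : Fin n), K (i * n + j) = 0 ∨ (K (i * n + j) = 1 ∧ 0 < X i j) := by
    intro i j
    have hlt := mul_add_lt i.isLt j.isLt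
    have h1 := hp.lt (i * n + j) (by omega)
    have h3 := hp.le (i * n + j) (by omega)
    have h4 := hx _ hlt
    have h5 := hf _ hlt
    rw [hxX] at h4
    have h6 := hX i j
    have h7 : (K₀ (i * n + j) : ℤ) < 2 ^ T := by
      have : (K₀ (i * n + j) : ℝ) < 2 ^ T := by nlinarith [h6.2]
      exact_mod_cast this
    -- Here `2 ^ T * K ≤ K₀ + (2 ^ T - 1) < 2 * 2 ^ T`.
    have h8 : K (i * n + j) ≤ 1 := by
      by_contra h9
      have : (2 : ℤ) ≤ K (i * n + j) := by omega
      nlinarith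
    rcases Nat.le_one_iff_eq_zero_or_eq_one.1 h8 with h9 | h9
    · exact .inl h9
    -- An entry equal to 0 has initial weight 0, which never grows. So the value 1 forces a positive
    -- entry, whose ceiling is 1.
    · refine .inr ⟨h9, ?_⟩
      have : (1 : ℝ) ≤ K₀ (i * n + j) := by exact_mod_cast h9 ▸ h3
      by_contra h10
      have h11 : X i j = 0 := le_antisymm (not_lt.1 h10) h6.1
      rw [h11] at h4; linarith
  refine ⟨fun i j => ?_, fun i j => ?_, fun i b => ?_, fun j b => ?_, ?_⟩
  · rcases hval i j with h | h
    · exact .inl h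
    · exact .inr h.1
  · have h6 := hX i j
    rcases hval i j with h | h
    · left
      rw [Int.floor_eq_zero_iff.2 h6]; simp [h]
    · right
      rw [(Int.ceil_eq_iff (z := 1)).2 ⟨by simpa using h.2, by simpa using h6.2.le⟩]; simp [h.1]
  · have hlt := mul_add_lt i.isLt b.isLt
    have e := mul_add_div_mod (i := i) b.isLt
    have h := hp.rows.1 (i * n + b) hlt
    rw [e.1] at h
    have := abs_sum_lt_one hL hr hx (fun q hq => hdum q (by omega)) (by omega) hlt h
    rw [Finset.sum_Ico_eq_sum_range, show (i : ℕ) * n + b + 1 - i * n = b + 1 by omega,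
      ← sum_Iic_fin b fun j => x ((i * n + j) / n * n + (i * n + j) % n * 1) -
        K ((i * n + j) / n * n + (i * n + j) % n * 1)] at this
    simpa only [mul_one, Nat.div_add_mod', hxX] using this
  · have hlt : (j : ℕ) * m + b < m * n := by
      rw [mul_comm m n]; exact mul_add_lt j.isLt b.isLt
    have e := mul_add_div_mod (i := j) b.isLt
    have h := hp.cols.1 (j * m + b) hlt
    rw [e.1] at h
    have := abs_sum_lt_one hL' hc hx (fun q hq => by
      rw [add_assoc]; exact hdum _ (by omega)) (by omega) hlt h
    rw [Finset.sum_Ico_eq_sum_range, show (j : ℕ) * m + b + 1 - j * m = b + 1 by omega,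
      ← sum_Iic_fin b fun i => x ((j * m + i) / m * 1 + (j * m + i) % m * n) -
        K ((j * m + i) / m * 1 + (j * m + i) % m * n)] at this
    convert this using 2
    refine Finset.sum_congr rfl fun i _ => ?_
    have e := mul_add_div_mod (i := j) i.isLt
    rw [e.1, e.2, mul_one, add_comm (j : ℕ), hxX]
  · have := abs_sum_lt_one hL hr hx (fun q hq => hdum q (by omega)) (Nat.zero_le _) le_rfl hp.rows.2
    rw [← Finset.range_eq_Ico, sum_range_mul] at this
    simpa only [mul_one, Nat.div_add_mod', hxX] using this

/-- For `N ≥ 2`, `Nat.log 2 N + 2 ≤ 3 * Nat.log 2 N ≤ (3 / log 2) * log N`, and `3 / log 2 < 5`. For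
`N = 1` the maximum with 1 takes over. -/
theorem log_bound {N : ℕ} (hN : 0 < N) :
    (N * (Nat.log 2 (N + N) + 1 : ℕ) : ℝ) ≤ 5 * max 1 ((N : ℝ) * Real.log N) := by
  have e : Nat.log 2 (N + N) = Nat.log 2 N + 1 := by
    rw [← two_mul, mul_comm, Nat.log_mul_base (by norm_num) (by omega)]
  rw [e]
  rcases Nat.lt_or_ge N 2 with h | h
  · obtain rfl : N = 1 := by omega
    norm_num
  · refine le_trans ?_ (mul_le_mul_of_nonneg_left (le_max_right _ _) (by norm_num))
    have h1 : 1 ≤ Nat.log 2 N := Nat.log_pos (by norm_num) h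
    have h2 : (Nat.log 2 N : ℝ) * Real.log 2 ≤ Real.log N := by
      rw [← Real.log_pow]
      refine Real.log_le_log (by positivity) ?_
      exact_mod_cast Nat.pow_log_le_self 2 (by omega)
    have h3 := Real.log_two_gt_d9
    have h4 : (1 : ℝ) ≤ Nat.log 2 N := by exact_mod_cast h1
    have h5 : ((Nat.log 2 N + 1 + 1 : ℕ) : ℝ) ≤ 5 * Real.log N := by
      push_cast
      nlinarith
    nlinarith [(Nat.cast_pos (α := ℝ)).2 hN]

end Rounding

/-! ### The theorem -/

open Rounding RealRAM

theorem theorem1 :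
    ∃ (p : RealRAM.Prog) (C : ℝ), ∀ (m n : ℕ), 0 < m → 0 < n →
      ∀ X : Matrix (Fin m) (Fin n) ℝ, (∀ i j, X i j ∈ Set.Ico (0 : ℝ) 1) →
        ∃ (t : ℕ) (s : RealRAM.State),
          RealRAM.Exec p (RealRAM.input X) t s ∧
          (t : ℝ) ≤ C * max 1 ((m : ℝ) * n * Real.log ((m : ℝ) * n)) ∧
          IsGoodRounding X (RealRAM.output m n s) := by
  refine ⟨roundingProgram, 6000, fun m n hm hn X hX => ?_⟩
  have hNpos : 0 < m * n := Nat.mul_pos hm hn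
  have hx : ∀ e < m * n, 0 ≤ (input X).rarr 0 e ∧ (input X).rarr 0 e < 1 := by
    intro e he
    simp only [input, he, and_self, dite_true]
    exact hX _ _
  obtain ⟨t, s, he, ht, hgood⟩ : Runs roundingProgram (input X) fun t s =>
      t ≤ 1200 * (m * n * (Nat.log 2 (m * n + m * n) + 1)) ∧
        IsGoodRounding X (output m n s) := by
    refine Runs.seq (prepare_spec hm hn rfl rfl rfl rfl (fun _ _ => rfl) hx) ?_
    rintro t₁ u - ⟨ht₁, h4, hs, f, hf, hL, hL'⟩
    have hr := hL.lineOrder_rows hn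
    have hc := hL'.lineOrder_cols hm
    set T := u.nreg 4 with hT
    have hNT : m * n + m * n < 2 ^ T := by
      rw [h4]; exact Nat.lt_pow_succ_log_self (by norm_num) _
    refine (rounds_spec hs hT.symm hr hc fun v hv => ?_).mono ?_
    · rcases Nat.lt_or_ge v (m * n) with h | h
      · have h1 := hf v h
        have h2 : (u.narr 0 v : ℝ) < 2 ^ T := by
          have := (hx v h).2
          have hp : (0 : ℝ) < 2 ^ T := by positivity
          nlinarith
        exact_mod_cast h2
      · refine lt_of_le_of_lt ?_ (show 1 < 2 ^ T by omega)
        rcases Nat.lt_or_ge v (m * n + m * n) with h' | h'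
        · have := hL.le_one (v - m * n) (by omega)
          rwa [show m * n + (v - m * n) = v by omega] at this
        · have := hL'.le_one (v - (m * n + m * n)) (by omega)
          rwa [show m * n + m * n + (v - (m * n + m * n)) = v by omega] at this
    · rintro t₂ s - ⟨ht₂, hp⟩
      refine ⟨?_, isGoodRounding_of_progress X hX (input_rarr X) hNT (fun e he => (hf e he).1)
        (fun e he => (hf e he).2) hr hc hL hL' hp⟩
      rw [← h4]
      have hT1 : 1 ≤ T := by omega
      have h1 : m * n ≤ m * n * T := Nat.le_mul_of_pos_right _ hT1
      have h2 : T ≤ m * n * T := Nat.le_mul_of_pos_left T hNpos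
      have e : (687 * (m * n) + 99) * T = 687 * (m * n * T) + 99 * T := by ring
      rw [e] at ht₂
      omega
  refine ⟨t, s, he, ?_, hgood⟩
  have h1 := log_bound hNpos
  have h2 : (t : ℝ) ≤ 1200 * ((m * n : ℕ) * (Nat.log 2 (m * n + m * n) + 1 : ℕ)) := by
    exact_mod_cast ht
  rw [Nat.cast_mul] at h1 h2
  linarith
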